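/- Let $\mathbb{F}$ be the class of all $1$-Lipschitz functions $f:\mathbb{R}\to[0,1]$ with $f(0)=0$. There is a universal constant $C>0$ with the following property. Let $(\mathcal F_t)_{t\ge -1}$ be an increasing sequence of $\sigma$-fields on a probability space, let $f_\star\in\mathbb{F}$ be $L_\star$-Lipschitz with $0\le L_\star<1$, and let $\sigma_w\ge 0$. Consider the autoregressive system $$x_{t+1}=f_\star(x_t)+w_t,\qquad t=0,1,2,\dots,$$ where $x_t$ is $\mathcal F_{t-1}$-measurable and takes values in $[-B,B]$, and where $w_t$ is $\mathcal F_t$-measurable, independent of $\mathcal F_{t-1}$, with $\mathbf E[w_t\mid\mathcal F_{t-1}]=0$, and conditionally $\sigma_w^2$-subgaussian given $\mathcal F_{t-1}$, that is, $\mathbf E[e^{s w_t}\mid\mathcal F_{t-1}]\le e^{s^2\sigma_w^2/2}$ almost surely for all $s\in\mathbb R$. Let $T\ge 1$ and let $\hat f$ be any least squares estimator, i.e. a random element of $\mathbb F$ ($\omega\mapsto\hat f_\omega(z)$ is measurable for each $z$) with $$\hat f\in\operatorname*{arg\,min}_{f\in\mathbb F}\ \frac1T\sum_{t=0}^{T-1}|x_{t+1}-f(x_t)|^2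 .$$ Let $\xi$ be independent of all other randomness, with law the uniform mixture $\frac1T\sum_{t=0}^{T-1}\mathrm{Law}(x_t)$. Then $|\hat f(\xi)-f_\star(\xi)|$ is integrable and $$\mathbf E\,|\hat f(\xi)-f_\star(\xi)|\ \le\ C\left[\frac{B}{(1-L_\star)^{2/3}}+B^{1/3}\sigma_w^{2/3}\right]T^{-1/3}.$$ In particular, for states in $[-1,1]$ (that is, $B=1$) the bound is $C\left[(1-L_\star)^{-2/3}+\sigma_w^{2/3}\right]T^{-1/3}$. -/

import Mathlib

open MeasureTheory ProbabilityTheory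
open scoped ENNReal NNReal

/-- The hypothesis class: all `1`-Lipschitz functions `f : ℝ → [0,1]` with `f 0 = 0`. -/
def lipClass : Set (ℝ → ℝ) :=
  {f | (∀ z, f z ∈ Set.Icc (0 : ℝ) 1) ∧ f 0 = 0 ∧ LipschitzWith 1 f}

/-- `X` is conditionally `v`-subgaussian given the σ-field `m`:
`E[exp (s (X - E[X | m])) | m] ≤ exp (s² v / 2)` almost surely, for every real `s`
(the two unit vectors of `ℝ` are accounted for by the sign of `s`). -/
def CondSubgaussian {Ω : Type*} (m : MeasurableSpace Ω) {mΩ : MeasurableSpace Ω}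
    (μ : Measure[mΩ] Ω) (X : Ω → ℝ) (v : ℝ) : Prop :=
  ∀ s : ℝ,
    Integrable (fun ω => Real.exp (s * (X ω - (μ[X | m]) ω))) μ ∧
    μ[fun ω => Real.exp (s * (X ω - (μ[X | m]) ω)) | m]
      ≤ᵐ[μ] fun _ => Real.exp (s ^ 2 * v / 2)

/-- The autoregressive model `x (t+1) = f (x t) + w t` with martingale-difference,
conditionally `σ²`-subgaussian noise. The filtration is indexed so that `𝓕 t` is the information
available just before `w t` is drawn: `x t` is `𝓕 t`-measurable and `w t` is
`𝓕 (t + 1)`-measurable. -/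
structure IsAutoregressive {Ω : Type*} {mΩ : MeasurableSpace Ω} (μ : Measure Ω)
    (𝓕 : Filtration ℕ mΩ) (f : ℝ → ℝ) (σ : ℝ) (x w : ℕ → Ω → ℝ) : Prop where
  measurable_state : ∀ t, Measurable[𝓕 t] (x t)
  measurable_noise : ∀ t, Measurable[𝓕 (t + 1)] (w t)
  step : ∀ t ω, x (t + 1) ω = f (x t ω) + w t ω
  integrable_noise : ∀ t, Integrable (w t) μ
  condExp_noise : ∀ t, μ[w t | 𝓕 t] =ᵐ[μ] 0
  subgaussian_noise : ∀ t, CondSubgaussian (𝓕 t) μ (w t) (σ ^ 2)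

/-- The empirical square loss of `f` on the trajectory `z 0, …, z T`, with covariates `z t` and
responses `z (t + 1)`, for `t < T`. -/
noncomputable def empiricalLoss (T : ℕ) (z : ℕ → ℝ) (f : ℝ → ℝ) : ℝ :=
  (1 / (T : ℝ)) * ∑ t ∈ Finset.range T, |z (t + 1) - f (z t)| ^ 2

/-- `g` is a least squares estimator over the class `F`, computed from `x 0, …, x T`: a random
function which at every outcome is a minimizer over `F` of the empirical square loss. -/
structure IsLSE {Ω : Type*} [MeasurableSpace Ω] (F : Set (ℝ → ℝ)) (T : ℕ)
    (x : ℕ → Ω → ℝ) (g : Ω → ℝ → ℝ) : Prop where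
  measurable : ∀ z, Measurable fun ω => g ω z
  mem : ∀ ω, g ω ∈ F
  isMinOn : ∀ ω, IsMinOn (empiricalLoss T fun t => x t ω) F (g ω)

/-- The uniform mixture of the laws of `x 0, …, x (T - 1)`. -/
noncomputable def mixtureLaw {Ω : Type*} [MeasurableSpace Ω] (μ : Measure Ω)
    (x : ℕ → Ω → ℝ) (T : ℕ) : Measure ℝ :=
  ((T : ℝ≥0∞)⁻¹) • ∑ t ∈ Finset.range T, μ.map (x t)

/-! The error splits into an in-sample part, controlled by the noise, and a generalisation part,
controlled by contraction of the dynamics.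

In-sample. Minimality gives `∑ (f̂ - f⋆)² ≤ 2 ∑ w (f̂ - f⋆)` along the trajectory. Cut `[-B, B]`
into `N` blocks of width `γ = 2B/N`, each made of `N` cells of width `δ = γ/N`. Rounding `f̂` at
block endpoints gives a step function from a net whose log-cardinality is at most `2N`, because a
rounded Lipschitz path has increments in `{-1, 0, 1}`. Net functions are handled by the offset
exponential supermartingale: half of the square on the left pays for the quadratic offset, and the
maximum over the net costs order `vN`. No further chaining is needed: the rounding error is a
combination of indicator-type functions with coefficients at most `δ` or `γ`, so duality bounds its
noise sum by an `ℓ¹` sum of martingales, whose second moments add up with bounded overlap. The total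
is of order `γ²T + γ√(vTN) + vN`; taking `N` near `B/a` with `a³T = vB` makes it of order `a²T`, and
Cauchy–Schwarz gives an absolute error of order `aT`.

Generalisation. For every outcome, `h = |f̂ - f⋆|` is 2-Lipschitz, hence within `4γ` of a constant
plus a combination of `N` ramps with slopes at most 2. Thus the deviation of `∑ h(x t)` from its
mean, uniformly over all such `h`, reduces to the deviations of `N` ramp sums. The ramps satisfy `∑ₖ
|rₖ y - rₖ z| ≤ |y - z|`; contraction carries this to the costs to go with constant `1/(1-L)`, and a
Doob decomposition bounds the variances of all ramp sums together by order `T (B/(1-L))²`, with no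
factor `N`. Balancing against `γT` gives `N` near `ρ` with `ρ³ = (1-L)²T`, that is, an error `B/ρ`
per step.

The lemmas carrying this are `sum_sq_le_of_lse`, `integral_sum_sq_lse_le`, `sum_integral_sub_le` and
`BoundedNoiseModel.sum_variance_le`. When a resolution degenerates, the trivial bound `B` suffices.
-/

/-- A bounded state process `x`, adapted to `𝓕`, driven by bounded centred noise `w` with
`w t` independent of `𝓕 t` and `v`-subgaussian. -/
structure BoundedNoiseModel {Ω : Type*} {mΩ : MeasurableSpace Ω} (μ : Measure Ω)
    (𝓕 : Filtration ℕ mΩ) (v b : ℝ) (x w : ℕ → Ω → ℝ) : Prop where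
  measurable_state : ∀ t, Measurable[𝓕 t] (x t)
  measurable_noise : ∀ t, Measurable[𝓕 (t + 1)] (w t)
  indep : ∀ t, Indep (MeasurableSpace.comap (w t) inferInstance) (𝓕 t) μ
  abs_noise_le : ∀ t ω, |w t ω| ≤ b
  integral_noise : ∀ t, ∫ ω, w t ω ∂μ = 0
  mgf_le : ∀ t s, ∫ ω, Real.exp (s * w t ω) ∂μ ≤ Real.exp (s ^ 2 * v / 2)

/-! ### Independence and second-moment preliminaries -/

/-- A bounded measurable function on a finite measure space is integrable. -/
lemma integrable_of_abs_le {Ω : Type*} {mΩ : MeasurableSpace Ω} {μ : Measure Ω} [IsFiniteMeasure μ]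
    {f : Ω → ℝ} (hf : Measurable f) {C : ℝ} (h : ∀ ω, |f ω| ≤ C) : Integrable f μ :=
  Integrable.of_bound hf.aestronglyMeasurable C (Filter.Eventually.of_forall h)

lemma indepFun_of_indep {Ω α : Type*} {m mΩ : MeasurableSpace Ω} [MeasurableSpace α]
    {μ : Measure Ω} {X : Ω → α} {W : Ω → ℝ} (hX : Measurable[m] X)
    (hind : Indep (MeasurableSpace.comap W inferInstance) m μ) : IndepFun X W μ := by
  rw [IndepFun_iff_Indep]
  exact (indep_of_indep_of_le_right hind hX.comap_le).symm

/-- Decoupling: a function of independent variables integrates as over two independent copies. -/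
lemma integral_prodMk_eq_of_indep {Ω α : Type*} {m mΩ : MeasurableSpace Ω} [MeasurableSpace α]
    {μ : Measure Ω} [IsProbabilityMeasure μ] (hm : m ≤ mΩ)
    {X : Ω → α} {W : Ω → ℝ} (hX : Measurable[m] X) (hW : Measurable W)
    (hind : Indep (MeasurableSpace.comap W inferInstance) m μ) {Φ : α × ℝ → ℝ}
    (hΦ : Measurable Φ) :
    ∫ ω, Φ (X ω, W ω) ∂μ = ∫ p, Φ (X p.1, W p.2) ∂(μ.prod μ) := by
  have hX' : Measurable X := hX.mono hm le_rfl
  have h1 := (indepFun_iff_map_prod_eq_prod_map_map hX'.aemeasurable hW.aemeasurable).1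
    (indepFun_of_indep hX hind)
  rw [Measure.map_prod_map μ μ hX' hW] at h1
  have h2 := integral_map (μ := μ) (hX'.prodMk hW).aemeasurable
    (f := Φ) hΦ.aestronglyMeasurable
  have h3 := integral_map (μ := μ.prod μ) (hX'.prodMap hW).aemeasurable
    (f := Φ) hΦ.aestronglyMeasurable
  rw [← h2, h1, h3]
  rfl

/-- The quadratic lower bound for the exponential is used on the nonnegative side and the tangent
line on the other. It extracts a second moment from a two-sided exponential moment. -/
lemma two_add_sq_div_two_le_exp_add_exp_neg (y : ℝ) :
    2 + y ^ 2 / 2 ≤ Real.exp y + Real.exp (-y) := by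
  rcases le_total 0 y with h | h
  · have h1 := Real.quadratic_le_exp_of_nonneg h
    have h2 := Real.add_one_le_exp (-y)
    linarith
  · have h1 := Real.quadratic_le_exp_of_nonneg (neg_nonneg.2 h)
    have h2 := Real.add_one_le_exp y
    nlinarith

/-- For a finite family, `E ∑ |Y i| ≤ √(card * ∑ E (Y i)²)`. -/
lemma integral_sum_abs_le_sqrt {Ω ι : Type*} {mΩ : MeasurableSpace Ω} {μ : Measure Ω}
    [IsProbabilityMeasure μ] (s : Finset ι) {Y : ι → Ω → ℝ} (hY : ∀ i, Measurable (Y i))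
    {C : ℝ} (hC : ∀ i ω, |Y i ω| ≤ C) {V : ℝ} (hV : ∑ i ∈ s, ∫ ω, Y i ω ^ 2 ∂μ ≤ V) :
    ∫ ω, ∑ i ∈ s, |Y i ω| ∂μ ≤ √(s.card * V) := by
  have hi : ∀ i, Integrable (fun ω => |Y i ω|) μ := fun i =>
    integrable_of_abs_le (hY i).abs (fun ω => by simpa using hC i ω)
  have hi2 : ∀ i, Integrable (fun ω => Y i ω ^ 2) μ := fun i =>
    integrable_of_abs_le ((hY i).pow_const 2) (C := C ^ 2) (fun ω => by
      rw [abs_pow]; exact pow_le_pow_left₀ (abs_nonneg _) (hC i ω) 2)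
  have hsq : ∀ i, (∫ ω, |Y i ω| ∂μ) ^ 2 ≤ ∫ ω, Y i ω ^ 2 ∂μ := by
    intro i
    set a := ∫ ω, |Y i ω| ∂μ
    have h0 : 0 ≤ ∫ ω, (|Y i ω| - a) ^ 2 ∂μ := integral_nonneg fun ω => sq_nonneg _
    have h1 : ∫ ω, (|Y i ω| - a) ^ 2 ∂μ = ∫ ω, Y i ω ^ 2 ∂μ - 2 * a * a + a ^ 2 := by
      have : ∀ ω, (|Y i ω| - a) ^ 2 = Y i ω ^ 2 - 2 * a * |Y i ω| + a ^ 2 := fun ω => by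
        rw [sub_sq, sq_abs]; ring
      simp_rw [this]
      have h2 : Integrable (fun ω => Y i ω ^ 2 - 2 * a * |Y i ω|) μ :=
        (hi2 i).sub ((hi i).const_mul _)
      rw [integral_add h2 (integrable_const _),
        integral_sub (hi2 i) ((hi i).const_mul _), integral_const_mul]
      simp [a]
    nlinarith
  rw [integral_finsetSum _ fun i _ => hi i]
  apply Real.le_sqrt_of_sq_le
  calc (∑ i ∈ s, ∫ ω, |Y i ω| ∂μ) ^ 2 ≤ s.card * ∑ i ∈ s, (∫ ω, |Y i ω| ∂μ) ^ 2 :=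
        sq_sum_le_card_mul_sum_sq
    _ ≤ s.card * V := by
        gcongr
        exact (Finset.sum_le_sum fun i _ => hsq i).trans hV

/-! ### Martingale estimates for noise sums -/

namespace BoundedNoiseModel

variable {Ω : Type*} {mΩ : MeasurableSpace Ω} {μ : Measure Ω}
  {𝓕 : Filtration ℕ mΩ} {v b : ℝ} {x w : ℕ → Ω → ℝ}

lemma noise_measurable (h : BoundedNoiseModel μ 𝓕 v b x w) (t : ℕ) : Measurable (w t) :=
  (h.measurable_noise t).mono (𝓕.le _) le_rfl

lemma state_measurable (h : BoundedNoiseModel μ 𝓕 v b x w) (t : ℕ) : Measurable (x t) :=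
  (h.measurable_state t).mono (𝓕.le _) le_rfl

variable [IsProbabilityMeasure μ]

lemma integrable_exp_noise (h : BoundedNoiseModel μ 𝓕 v b x w) (t : ℕ) (s : ℝ) :
    Integrable (fun ω => Real.exp (s * w t ω)) μ := by
  refine integrable_of_abs_le (((h.noise_measurable t).const_mul s).exp)
    (C := Real.exp (|s| * b)) fun ω => ?_
  rw [Real.abs_exp]
  apply Real.exp_le_exp.2
  calc s * w t ω ≤ |s * w t ω| := le_abs_self _
    _ = |s| * |w t ω| := abs_mul _ _
    _ ≤ _ := by gcongr; exact h.abs_noise_le t ω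

lemma integrable_noise_sq (h : BoundedNoiseModel μ 𝓕 v b x w) (t : ℕ) :
    Integrable (fun ω => w t ω ^ 2) μ :=
  integrable_of_abs_le ((h.noise_measurable t).pow_const 2) (C := b ^ 2) (fun ω => by
      rw [abs_pow]; exact pow_le_pow_left₀ (abs_nonneg _) (h.abs_noise_le t ω) 2)

lemma integral_noise_sq_le (h : BoundedNoiseModel μ 𝓕 v b x w) (hv : 0 < v) (t : ℕ) :
    ∫ ω, w t ω ^ 2 ∂μ ≤ 4 * v := by
  -- At this scale both exponential moments are at most `exp (1/2) ≤ 2`, which produces the constant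
  -- 4.
  set s := (√v)⁻¹
  have hs : s ^ 2 * v = 1 := by
    simp only [s, inv_pow, Real.sq_sqrt hv.le]; exact inv_mul_cancel₀ hv.ne'
  have h1 := h.mgf_le t s
  have h2 := h.mgf_le t (-s)
  rw [neg_sq, hs] at h2
  rw [hs] at h1
  have h3 : ∫ ω, (2 + s ^ 2 / 2 * w t ω ^ 2) ∂μ
      ≤ ∫ ω, (Real.exp (s * w t ω) + Real.exp (-s * w t ω)) ∂μ := by
    refine integral_mono ((integrable_const _).add ((h.integrable_noise_sq t).const_mul _))
      ((h.integrable_exp_noise t s).add (h.integrable_exp_noise t (-s))) fun ω => ?_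
    have := two_add_sq_div_two_le_exp_add_exp_neg (s * w t ω)
    rw [mul_pow] at this
    rw [neg_mul]
    dsimp only
    linarith
  rw [integral_add (integrable_const _) ((h.integrable_noise_sq t).const_mul _),
    integral_add (h.integrable_exp_noise t s) (h.integrable_exp_noise t (-s)),
    integral_const_mul] at h3
  have h4 : Real.exp (1 / 2) ≤ 2 := by
    have h5 : Real.exp (1 / 2) ^ 2 = Real.exp 1 := by
      rw [← Real.exp_nat_mul]; norm_num
    have h6 := Real.exp_one_lt_d9
    nlinarith [Real.exp_pos (1 / 2)]
  simp only [integral_const, probReal_univ, one_smul] at h3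
  have h7 : s ^ 2 * ∫ ω, w t ω ^ 2 ∂μ ≤ 4 := by linarith
  calc ∫ ω, w t ω ^ 2 ∂μ = v * (s ^ 2 * ∫ ω, w t ω ^ 2 ∂μ) := by
        rw [← mul_assoc, mul_comm v, hs, one_mul]
    _ ≤ v * 4 := by gcongr
    _ = 4 * v := by ring

/-- Second moment of a martingale transform of the noise. -/
lemma integral_sq_sum_noise_mul_le (h : BoundedNoiseModel μ 𝓕 v b x w) (hv : 0 < v)
    {φ : ℝ → ℝ} (hφ : Measurable φ) (hφ1 : ∀ z, |φ z| ≤ 1) (n : ℕ) :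
    ∫ ω, (∑ t ∈ Finset.range n, w t ω * φ (x t ω)) ^ 2 ∂μ
      ≤ 4 * v * ∑ t ∈ Finset.range n, ∫ ω, φ (x t ω) ^ 2 ∂μ := by
  induction n with
  | zero => simp
  | succ n ih =>
    set M : Ω → ℝ := fun ω => ∑ t ∈ Finset.range n, w t ω * φ (x t ω) with hM
    have hMm : Measurable[𝓕 n] M := by
      refine Finset.measurable_sum _ fun t ht => ?_
      have ht' := Finset.mem_range.1 ht
      exact ((h.measurable_noise t).mono (𝓕.mono ht') le_rfl).mul
        (hφ.comp ((h.measurable_state t).mono (𝓕.mono ht'.le) le_rfl))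
    have hM' : Measurable M := hMm.mono (𝓕.le _) le_rfl
    have hb : ∀ t ω, |w t ω * φ (x t ω)| ≤ b := fun t ω => by
      rw [abs_mul]
      calc |w t ω| * |φ (x t ω)| ≤ |w t ω| * 1 := by gcongr; exact hφ1 _
        _ ≤ b := by rw [mul_one]; exact h.abs_noise_le t ω
    have hMb : ∀ ω, |M ω| ≤ n * b := fun ω => by
      refine (Finset.abs_sum_le_sum_abs _ _).trans ?_
      refine (Finset.sum_le_sum fun t _ => hb t ω).trans ?_
      simp
    have hφm : Measurable[𝓕 n] fun ω => φ (x n ω) := hφ.comp (h.measurable_state n)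
    have hφm' : Measurable fun ω => φ (x n ω) := hφm.mono (𝓕.le _) le_rfl
    have hwm := h.noise_measurable n
    -- The cross term vanishes: `M * φ (x n)` is known before the centred, independent `w n` is
    -- drawn.
    have e1 : ∫ ω, (M ω * φ (x n ω)) * w n ω ∂μ = 0 := by
      have := (indepFun_of_indep (hMm.mul hφm) (h.indep n)).integral_fun_mul_eq_mul_integral
        (hM'.mul hφm').aestronglyMeasurable hwm.aestronglyMeasurable
      simp only [Pi.mul_apply] at this
      rw [this, h.integral_noise n, mul_zero]
    have e2 : ∫ ω, φ (x n ω) ^ 2 * w n ω ^ 2 ∂μ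
        = (∫ ω, φ (x n ω) ^ 2 ∂μ) * ∫ ω, w n ω ^ 2 ∂μ := by
      have h1 := (indepFun_of_indep hφm (h.indep n)).comp
        (measurable_id.pow_const 2) (measurable_id.pow_const 2)
      exact h1.integral_fun_mul_eq_mul_integral
        (hφm'.pow_const 2).aestronglyMeasurable (hwm.pow_const 2).aestronglyMeasurable
    have i1 : Integrable (fun ω => M ω ^ 2) μ :=
      integrable_of_abs_le (hM'.pow_const 2) (C := (n * b) ^ 2) fun ω => by
        rw [abs_pow]; exact pow_le_pow_left₀ (abs_nonneg _) (hMb ω) 2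
    have i2 : Integrable (fun ω => (M ω * φ (x n ω)) * w n ω) μ :=
      integrable_of_abs_le ((hM'.mul hφm').mul hwm) (C := (n * b) * b) fun ω => by
        rw [mul_assoc, abs_mul, mul_comm (φ _)]
        exact mul_le_mul (hMb ω) (hb n ω) (abs_nonneg _) ((abs_nonneg _).trans (hMb ω))
    have i3 : Integrable (fun ω => φ (x n ω) ^ 2 * w n ω ^ 2) μ :=
      integrable_of_abs_le ((hφm'.pow_const 2).mul (hwm.pow_const 2)) (C := b ^ 2) fun ω => by
        rw [← mul_pow, mul_comm (φ _), abs_pow]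
        exact pow_le_pow_left₀ (abs_nonneg _) (hb n ω) 2
    have e3 : ∀ ω, (∑ t ∈ Finset.range (n + 1), w t ω * φ (x t ω)) ^ 2
        = M ω ^ 2 + 2 * ((M ω * φ (x n ω)) * w n ω) + φ (x n ω) ^ 2 * w n ω ^ 2 := fun ω => by
      rw [Finset.sum_range_succ]; simp only [hM]; ring
    simp_rw [e3]
    have i4 : Integrable (fun ω => M ω ^ 2 + 2 * ((M ω * φ (x n ω)) * w n ω)) μ :=
      i1.add (i2.const_mul 2)
    rw [integral_add i4 i3, integral_add i1 (i2.const_mul 2),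
      integral_const_mul, e1, e2, Finset.sum_range_succ, mul_add]
    have hφ0 : 0 ≤ ∫ ω, φ (x n ω) ^ 2 ∂μ := integral_nonneg fun ω => sq_nonneg _
    have := mul_le_mul_of_nonneg_left (h.integral_noise_sq_le hv n) hφ0
    linarith

/-- Maximal inequality, in `ℓ¹` form, for martingale transforms by a family of functions with
bounded overlap. -/
lemma integral_sum_abs_noise_le (h : BoundedNoiseModel μ 𝓕 v b x w) (hv : 0 < v)
    {φ : ℕ → ℝ → ℝ} (hφ : ∀ i, Measurable (φ i)) (hφ1 : ∀ i z, |φ i z| ≤ 1) (n T : ℕ) {K : ℝ}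
    (hK : ∀ z, ∑ i ∈ Finset.range n, φ i z ^ 2 ≤ K) :
    ∫ ω, ∑ i ∈ Finset.range n, |∑ t ∈ Finset.range T, w t ω * φ i (x t ω)| ∂μ
      ≤ √(n * (4 * v * (T * K))) := by
  have hm : ∀ i t, Measurable fun ω => φ i (x t ω) := fun i t =>
    (hφ i).comp (h.state_measurable t)
  have key := integral_sum_abs_le_sqrt (μ := μ) (Finset.range n)
    (Y := fun i ω => ∑ t ∈ Finset.range T, w t ω * φ i (x t ω))
    (fun i => Finset.measurable_sum _ fun t _ => (h.noise_measurable t).mul (hm i t))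
    (C := T * b) (fun i ω => by
      refine (Finset.abs_sum_le_sum_abs _ _).trans ?_
      refine (Finset.sum_le_sum fun t _ => (?_ : _ ≤ b)).trans (by simp)
      rw [abs_mul]
      calc |w t ω| * |φ i (x t ω)| ≤ |w t ω| * 1 := by gcongr; exact hφ1 _ _
        _ ≤ b := by rw [mul_one]; exact h.abs_noise_le t ω)
    (V := 4 * v * (T * K)) ?_
  · simpa using key
  refine (Finset.sum_le_sum fun i _ =>
    h.integral_sq_sum_noise_mul_le hv (hφ i) (hφ1 i) T).trans ?_
  -- With time outermost, the overlap bound applies pointwise at each state.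
  rw [← Finset.mul_sum, Finset.sum_comm]
  gcongr
  have : ∀ t ∈ Finset.range T, ∑ i ∈ Finset.range n, ∫ ω, φ i (x t ω) ^ 2 ∂μ ≤ K := by
    intro t _
    have hi : ∀ i, Integrable (fun ω => φ i (x t ω) ^ 2) μ := fun i =>
      integrable_of_abs_le ((hm i t).pow_const 2) (C := 1) fun ω => by
        rw [abs_pow]; exact pow_le_one₀ (abs_nonneg _) (hφ1 _ _)
    rw [← integral_finsetSum _ fun i _ => hi i]
    refine (integral_mono (integrable_finsetSum _ fun i _ => hi i) (integrable_const K)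
      fun ω => hK (x t ω)).trans ?_
    simp
  refine (Finset.sum_le_sum this).trans ?_
  simp

/-- The offset exponential supermartingale. -/
lemma integral_exp_sum_le_one (h : BoundedNoiseModel μ 𝓕 v b x w) {g : ℝ → ℝ}
    (hg : Measurable g) {C : ℝ} (hC : ∀ z, |g z| ≤ C) (n : ℕ) :
    ∫ ω, Real.exp (∑ t ∈ Finset.range n,
      (g (x t ω) * w t ω - g (x t ω) ^ 2 * v / 2)) ∂μ ≤ 1 := by
  induction n with
  | zero => simp
  | succ n ih =>
    set Z : Ω → ℝ := fun ω => ∑ t ∈ Finset.range n,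
      (g (x t ω) * w t ω - g (x t ω) ^ 2 * v / 2) with hZ
    have hgm : ∀ t, Measurable[𝓕 t] fun ω => g (x t ω) := fun t =>
      hg.comp (h.measurable_state t)
    have hZm : Measurable[𝓕 n] Z := by
      refine Finset.measurable_sum _ fun t ht => ?_
      have ht' := Finset.mem_range.1 ht
      have h1 := (hgm t).mono (𝓕.mono ht'.le) le_rfl
      have h2 := (h.measurable_noise t).mono (𝓕.mono ht') le_rfl
      exact (h1.mul h2).sub (((h1.pow_const 2).mul_const _).div_const _)
    have hZ' : Measurable Z := hZm.mono (𝓕.le _) le_rfl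
    have hgx : Measurable fun ω => g (x n ω) := (hgm n).mono (𝓕.le _) le_rfl
    have hwm := h.noise_measurable n
    have hpm : Measurable fun p : Ω × Ω =>
        Real.exp (Z p.1 + (g (x n p.1) * w n p.2 - g (x n p.1) ^ 2 * v / 2)) :=
      ((hZ'.comp measurable_fst).add ((((hgx.comp measurable_fst).mul
        (hwm.comp measurable_snd)).sub ((((hgx.comp measurable_fst).pow_const 2).mul_const
        _).div_const _)))).exp
    have hbd : ∀ t ω ω', |g (x t ω) * w t ω' - g (x t ω) ^ 2 * v / 2|
        ≤ C * b + C ^ 2 * |v| / 2 := fun t ω ω' => by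
      refine (abs_sub _ _).trans ?_
      rw [abs_mul, abs_div, abs_mul, abs_pow, abs_two]
      have h1 := h.abs_noise_le t ω'
      have h2 := hC (x t ω)
      have h3 := (abs_nonneg _).trans h2
      have h4 := pow_le_pow_left₀ (abs_nonneg _) h2 2
      gcongr
    have hZb : ∀ ω, Z ω ≤ n * (C * b + C ^ 2 * |v| / 2) := fun ω => by
      refine (Finset.sum_le_sum fun t _ => (le_abs_self _).trans (hbd t ω ω)).trans ?_
      simp [mul_add]
    have hZi : Integrable (fun ω => Real.exp (Z ω)) μ :=
      integrable_of_abs_le hZ'.exp fun ω => by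
        rw [Real.abs_exp]; exact Real.exp_le_exp.2 (hZb ω)
    -- The new noise is replaced by an independent copy, so the inner integral is its moment
    -- generating function at the frozen value `g (x n)`, and the offset cancels exactly its bound.
    have e1 : ∫ ω, Real.exp (∑ t ∈ Finset.range (n + 1),
        (g (x t ω) * w t ω - g (x t ω) ^ 2 * v / 2)) ∂μ
        = ∫ p : Ω × Ω, Real.exp (Z p.1 + (g (x n p.1) * w n p.2 - g (x n p.1) ^ 2 * v / 2))
          ∂(μ.prod μ) := by
      have := integral_prodMk_eq_of_indep (μ := μ) (𝓕.le n) (X := fun ω => (Z ω, g (x n ω)))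
        (hZm.prodMk (hgm n)) hwm (h.indep n)
        (Φ := fun q => Real.exp (q.1.1 + (q.1.2 * q.2 - q.1.2 ^ 2 * v / 2))) (by fun_prop)
      simp only at this
      rw [← this]
      simp_rw [Finset.sum_range_succ, hZ]
    have hi : Integrable (fun p : Ω × Ω =>
        Real.exp (Z p.1 + (g (x n p.1) * w n p.2 - g (x n p.1) ^ 2 * v / 2))) (μ.prod μ) := by
      refine integrable_of_abs_le hpm
        (C := Real.exp (n * (C * b + C ^ 2 * |v| / 2) + (C * b + C ^ 2 * |v| / 2))) fun p => ?_
      rw [Real.abs_exp]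
      exact Real.exp_le_exp.2 (add_le_add (hZb _) ((le_abs_self _).trans (hbd n _ _)))
    rw [e1, integral_prod _ hi]
    refine (integral_mono hi.integral_prod_left hZi fun ω => ?_).trans ih
    have e2 : ∀ ω', Real.exp (Z ω + (g (x n ω) * w n ω' - g (x n ω) ^ 2 * v / 2))
        = Real.exp (Z ω - g (x n ω) ^ 2 * v / 2) * Real.exp (g (x n ω) * w n ω') := fun ω' => by
      rw [← Real.exp_add]; congr 1; ring
    simp_rw [e2]
    rw [integral_const_mul]
    calc _ ≤ Real.exp (Z ω - g (x n ω) ^ 2 * v / 2) * Real.exp (g (x n ω) ^ 2 * v / 2) := by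
          gcongr; exact h.mgf_le n _
      _ = Real.exp (Z ω) := by rw [← Real.exp_add]; congr 1; ring

end BoundedNoiseModel

/-! ### Coding of integer paths -/

/-- The integer path with start `c.1` and increments in `{-1, 0, 1}` coded by `c.2`. -/
def decodePath {N : ℕ} (c : Fin (N + 1) × (Fin N → Fin 3)) (k : ℕ) : ℤ :=
  (c.1 : ℕ) + ∑ i : Fin N, if (i : ℕ) < k then ((c.2 i : ℕ) : ℤ) - 1 else 0

lemma abs_decodePath_le {N : ℕ} (c : Fin (N + 1) × (Fin N → Fin 3)) (k : ℕ) :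
    |decodePath c k| ≤ 2 * N := by
  have h1 : |∑ i : Fin N, if (i : ℕ) < k then ((c.2 i : ℕ) : ℤ) - 1 else 0| ≤ N := by
    refine (Finset.abs_sum_le_sum_abs _ _).trans ?_
    have : ∀ i ∈ Finset.univ (α := Fin N),
        |if (i : ℕ) < k then ((c.2 i : ℕ) : ℤ) - 1 else 0| ≤ 1 := fun i _ => by
      have := (c.2 i).isLt
      split_ifs
      · rw [abs_le]; constructor <;> omega
      · simp
    refine (Finset.sum_le_sum this).trans ?_
    simp
  have h2 := c.1.isLt
  rw [abs_le] at h1 ⊢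
  unfold decodePath
  constructor <;> omega

/-- Every integer path with small start and increments in `{-1, 0, 1}` is coded. -/
lemma exists_decodePath_eq {N : ℕ} (q : ℕ → ℤ) (h0 : 0 ≤ q 0) (hN : q 0 ≤ N)
    (hq : ∀ k, |q (k + 1) - q k| ≤ 1) :
    ∃ c : Fin (N + 1) × (Fin N → Fin 3), ∀ k ≤ N, decodePath c k = q k := by
  have hq' : ∀ k, -1 ≤ q (k + 1) - q k ∧ q (k + 1) - q k ≤ 1 := fun k => abs_le.1 (hq k)
  refine ⟨(⟨(q 0).toNat, by omega⟩, fun i => ⟨(q (i + 1) - q i + 1).toNat, by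
    have := hq' i; omega⟩), fun k hk => ?_⟩
  unfold decodePath
  have e1 : ∀ i : Fin N, (if (i : ℕ) < k then (((q (i + 1) - q i + 1).toNat : ℕ) : ℤ) - 1 else 0)
      = (fun i : ℕ => if i < k then q (i + 1) - q i else 0) i := fun i => by
    have := hq' i
    dsimp only
    split_ifs
    · omega
    · rfl
  dsimp only
  rw [Finset.sum_congr rfl fun i _ => e1 i,
    Fin.sum_univ_eq_sum_range (fun i : ℕ => if i < k then q (i + 1) - q i else 0) N,
    ← Finset.sum_filter]
  have e2 : (Finset.range N).filter (fun i => i < k) = Finset.range k := by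
    ext i; simp; omega
  rw [e2, Finset.sum_range_sub]
  omega

/-- Consecutive indices are what makes the increments of a function telescope from the left end of a
block to a cell inside it. -/
lemma filter_block_eq_Ico {N n j : ℕ} (hN : 0 < N) (hj : j ≤ n) :
    (Finset.range n).filter (fun i => i < j ∧ i / N = j / N) = Finset.Ico (j / N * N) j := by
  ext i
  simp only [Finset.mem_filter, Finset.mem_range, Finset.mem_Ico]
  constructor
  · rintro ⟨_, h2, h3⟩
    exact ⟨h3 ▸ Nat.div_mul_le_self i N, h2⟩
  · rintro ⟨h1, h2⟩
    refine ⟨by omega, h2, le_antisymm (Nat.div_le_div_right h2.le) ?_⟩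
    exact (Nat.le_div_iff_mul_le hN).2 h1

/-! ### The two-scale grid and the net -/

/-- Index of the cell of the grid `-B + δ ℕ` that contains `z`. -/
noncomputable def gridIdx (B δ z : ℝ) : ℕ := ⌊(z + B) / δ⌋₊

lemma measurable_gridIdx (B δ : ℝ) : Measurable (gridIdx B δ) :=
  Nat.measurable_floor.comp ((measurable_id.add_const B).div_const δ)

lemma gridIdx_le {B δ z : ℝ} (hδ : 0 < δ) (hz : -B ≤ z) : -B + gridIdx B δ z * δ ≤ z := by
  have h := Nat.floor_le (div_nonneg (by linarith : 0 ≤ z + B) hδ.le)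
  rw [le_div_iff₀ hδ] at h
  unfold gridIdx
  linarith

lemma lt_gridIdx_add_one {B δ z : ℝ} (hδ : 0 < δ) : z < -B + (gridIdx B δ z + 1) * δ := by
  have h := Nat.lt_floor_add_one ((z + B) / δ)
  rw [div_lt_iff₀ hδ] at h
  unfold gridIdx
  linarith

/-- Indicator that `z` lies above fine cell `i`, inside the same block of `N` fine cells. -/
noncomputable def blockStep (B δ : ℝ) (N i : ℕ) (z : ℝ) : ℝ :=
  if i < gridIdx B δ z ∧ i / N = gridIdx B δ z / N then 1 else 0

/-- Indicator that `z` lies in block `k`, a block being `N` fine cells. -/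
noncomputable def blockInd (B δ : ℝ) (N k : ℕ) (z : ℝ) : ℝ :=
  if gridIdx B δ z / N = k then 1 else 0

lemma measurable_blockStep (B δ : ℝ) (N i : ℕ) : Measurable (blockStep B δ N i) :=
  (measurable_from_nat (f := fun j => if i < j ∧ i / N = j / N then (1 : ℝ) else 0)).comp
    (measurable_gridIdx B δ)

lemma measurable_blockInd (B δ : ℝ) (N k : ℕ) : Measurable (blockInd B δ N k) :=
  (measurable_from_nat (f := fun j => if j / N = k then (1 : ℝ) else 0)).comp
    (measurable_gridIdx B δ)

lemma abs_blockStep_le (B δ : ℝ) (N i : ℕ) (z : ℝ) : |blockStep B δ N i z| ≤ 1 := by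
  unfold blockStep; split_ifs <;> simp

lemma abs_blockInd_le (B δ : ℝ) (N k : ℕ) (z : ℝ) : |blockInd B δ N k z| ≤ 1 := by
  unfold blockInd; split_ifs <;> simp

/-- A point activates only the cells below it in its own block, hence fewer than `N` of them.
Restarting at each block keeps the overlap at `N` instead of `N²`. -/
lemma sum_blockStep_sq_le (B δ : ℝ) {N : ℕ} (hN : 0 < N) (n : ℕ) (z : ℝ) :
    ∑ i ∈ Finset.range n, blockStep B δ N i z ^ 2 ≤ N := by
  set j := gridIdx B δ z with hj
  have e : ∀ i, blockStep B δ N i z ^ 2 = if i < j ∧ i / N = j / N then 1 else 0 := fun i => by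
    unfold blockStep; rw [← hj]; split_ifs <;> simp
  simp_rw [e]
  -- The range is enlarged to reach `j`, so that the active indices form a full interval.
  have h1 : (∑ i ∈ Finset.range n, if i < j ∧ i / N = j / N then (1 : ℝ) else 0)
      ≤ ∑ i ∈ Finset.range (max n j), if i < j ∧ i / N = j / N then (1 : ℝ) else 0 :=
    Finset.sum_le_sum_of_subset_of_nonneg (Finset.range_mono (le_max_left _ _))
      fun i _ _ => by split_ifs <;> simp
  refine h1.trans ?_
  rw [← Finset.sum_filter, filter_block_eq_Ico hN (le_max_right _ _)]
  simp only [Finset.sum_const, Nat.card_Ico, nsmul_eq_mul, mul_one, Nat.cast_le]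
  have := Nat.div_add_mod' j N
  have := Nat.mod_lt j hN
  omega

lemma sum_blockInd_sq_le (B δ : ℝ) (N n : ℕ) (z : ℝ) :
    ∑ k ∈ Finset.range n, blockInd B δ N k z ^ 2 ≤ 1 := by
  have e : ∀ k, blockInd B δ N k z ^ 2 = if gridIdx B δ z / N = k then 1 else 0 := fun k => by
    unfold blockInd; split_ifs <;> simp
  simp_rw [e]
  rw [Finset.sum_ite_eq]
  split_ifs <;> simp

/-- The step function on blocks coded by an integer path. -/
noncomputable def netFun (B δ γ : ℝ) {N : ℕ} (c : Fin (N + 1) × (Fin N → Fin 3)) (z : ℝ) : ℝ :=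
  γ * decodePath c (gridIdx B δ z / N)

lemma measurable_netFun (B δ γ : ℝ) {N : ℕ} (c : Fin (N + 1) × (Fin N → Fin 3)) :
    Measurable (netFun B δ γ c) :=
  (measurable_from_nat (f := fun j => γ * (decodePath c (j / N) : ℝ))).comp
    (measurable_gridIdx B δ)

/-- A crude bound, needed only for integrability of the exponentials; it does not enter the rate. -/
lemma abs_netFun_le (B δ : ℝ) {γ : ℝ} (hγ : 0 ≤ γ) {N : ℕ} (c : Fin (N + 1) × (Fin N → Fin 3))
    (z : ℝ) : |netFun B δ γ c z| ≤ γ * (2 * N) := by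
  unfold netFun
  rw [abs_mul, abs_of_nonneg hγ]
  have := abs_decodePath_le c (gridIdx B δ z / N)
  gcongr
  exact_mod_cast this

/-! ### Two-scale approximation of Lipschitz functions -/

lemma abs_sub_le_of_mem_lipClass {f : ℝ → ℝ} (hf : f ∈ lipClass) (y z : ℝ) :
    |f y - f z| ≤ |y - z| := by
  simpa [Real.dist_eq] using hf.2.2.dist_le_mul y z

lemma abs_le_of_mem_lipClass {f : ℝ → ℝ} (hf : f ∈ lipClass) (z : ℝ) : |f z| ≤ |z| := by
  simpa [hf.2.1] using abs_sub_le_of_mem_lipClass hf z 0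

/-- Quantisation of a member of `lipClass` at the block endpoints. -/
lemma exists_netFun_close {f : ℝ → ℝ} (hf : f ∈ lipClass) {B γ : ℝ} (hγ : 0 < γ) {N : ℕ}
    (hB : 0 ≤ B) (hBN : B ≤ N * γ) :
    ∃ c : Fin (N + 1) × (Fin N → Fin 3), ∀ k ≤ N,
      |f (-B + k * γ) - γ * decodePath c k| ≤ γ := by
  -- The condition `f 0 = 0` gives `f (-B) ≤ B ≤ N γ`, so `N + 1` starting values suffice.
  have hq0 : ⌊f (-B + (0 : ℕ) * γ) / γ⌋ ≤ N := by
    have h1 : f (-B + (0 : ℕ) * γ) / γ ≤ N := by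
      rw [div_le_iff₀ hγ]
      refine (le_abs_self _).trans ((abs_le_of_mem_lipClass hf _).trans ?_)
      simpa [abs_of_nonneg hB] using hBN
    have h2 : ((⌊f (-B + (0 : ℕ) * γ) / γ⌋ : ℤ) : ℝ) ≤ N := (Int.floor_le _).trans h1
    exact_mod_cast h2
  have hq : ∀ k : ℕ, |⌊f (-B + (k + 1 : ℕ) * γ) / γ⌋ - ⌊f (-B + k * γ) / γ⌋| ≤ 1 := by
    intro k
    have h0 : |f (-B + (k + 1 : ℕ) * γ) - f (-B + k * γ)| ≤ γ := by
      refine (abs_sub_le_of_mem_lipClass hf _ _).trans ?_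
      rw [show -B + ((k + 1 : ℕ) : ℝ) * γ - (-B + k * γ) = γ by push_cast; ring,
        abs_of_pos hγ]
    rw [abs_le] at h0
    have h1 : f (-B + (k + 1 : ℕ) * γ) / γ ≤ f (-B + k * γ) / γ + 1 := by
      rw [div_add_one hγ.ne']; gcongr; linarith
    have h2 : f (-B + k * γ) / γ ≤ f (-B + (k + 1 : ℕ) * γ) / γ + 1 := by
      rw [div_add_one hγ.ne']; gcongr; linarith
    have h3 := Int.floor_le_floor h1
    have h4 := Int.floor_le_floor h2
    rw [Int.floor_add_one] at h3 h4
    rw [abs_le]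
    constructor <;> linarith
  obtain ⟨c, hc⟩ := exists_decodePath_eq (N := N) (fun k => ⌊f (-B + k * γ) / γ⌋)
    (Int.floor_nonneg.2 (div_nonneg (hf.1 _).1 hγ.le)) hq0 hq
  refine ⟨c, fun k hk => ?_⟩
  rw [hc k hk]
  have h1 := Int.floor_le (f (-B + k * γ) / γ)
  have h2 := Int.lt_floor_add_one (f (-B + k * γ) / γ)
  rw [le_div_iff₀ hγ] at h1
  rw [div_lt_iff₀ hγ] at h2
  rw [abs_le]
  constructor <;> linarith

/-- Expansion of the error of block quantisation in the functions `blockStep` and `blockInd`. -/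
lemma sub_netFun_eq (f : ℝ → ℝ) (B δ γ : ℝ) {N : ℕ} (hN : 0 < N)
    (c : Fin (N + 1) × (Fin N → Fin 3)) {z : ℝ} {n : ℕ} (hn : gridIdx B δ z ≤ n)
    (hnN : n / N ≤ N) :
    f z - netFun B δ γ c z = (f z - f (-B + gridIdx B δ z * δ))
      + ∑ i ∈ Finset.range n, (f (-B + (i + 1 : ℕ) * δ) - f (-B + i * δ)) * blockStep B δ N i z
      + ∑ k ∈ Finset.range (N + 1), (f (-B + (k * N : ℕ) * δ) - γ * decodePath c k)
          * blockInd B δ N k z := by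
  set j := gridIdx B δ z with hj
  have hk : j / N < N + 1 := Nat.lt_succ_of_le ((Nat.div_le_div_right hn).trans hnN)
  -- Telescoping from the left end of the block of `z` to the left end of its fine cell.
  have e1 : ∑ i ∈ Finset.range n,
      (f (-B + (i + 1 : ℕ) * δ) - f (-B + i * δ)) * blockStep B δ N i z
      = f (-B + j * δ) - f (-B + (j / N * N : ℕ) * δ) := by
    unfold blockStep
    rw [← hj]
    simp_rw [mul_ite, mul_one, mul_zero]
    rw [← Finset.sum_filter, filter_block_eq_Ico hN hn,
      Finset.sum_Ico_eq_sub _ (Nat.div_mul_le_self j N),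
      Finset.sum_range_sub (fun i : ℕ => f (-B + i * δ)),
      Finset.sum_range_sub (fun i : ℕ => f (-B + i * δ))]
    ring
  have e2 : ∑ k ∈ Finset.range (N + 1), (f (-B + (k * N : ℕ) * δ) - γ * decodePath c k)
      * blockInd B δ N k z
      = f (-B + (j / N * N : ℕ) * δ) - γ * decodePath c (j / N) := by
    unfold blockInd
    rw [← hj]
    simp_rw [mul_ite, mul_one, mul_zero]
    rw [Finset.sum_ite_eq, if_pos (Finset.mem_range.2 hk)]
  rw [e1, e2, netFun, ← hj]
  ring

/-- `|∑ₜ wₜ ∑ᵢ aᵢ φᵢ(xₜ)| ≤ r ∑ᵢ |∑ₜ wₜ φᵢ(xₜ)|` when all `|aᵢ| ≤ r`. -/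
lemma abs_sum_mul_sum_le (T n : ℕ) (w x : ℕ → ℝ) (a : ℕ → ℝ) (φ : ℕ → ℝ → ℝ) {r : ℝ}
    (ha : ∀ i < n, |a i| ≤ r) :
    |∑ t ∈ Finset.range T, w t * ∑ i ∈ Finset.range n, a i * φ i (x t)|
      ≤ r * ∑ i ∈ Finset.range n, |∑ t ∈ Finset.range T, w t * φ i (x t)| := by
  have e : ∑ t ∈ Finset.range T, w t * ∑ i ∈ Finset.range n, a i * φ i (x t)
      = ∑ i ∈ Finset.range n, a i * ∑ t ∈ Finset.range T, w t * φ i (x t) := by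
    simp_rw [Finset.mul_sum]
    rw [Finset.sum_comm]
    exact Finset.sum_congr rfl fun i _ => Finset.sum_congr rfl fun t _ => by ring
  rw [e, Finset.mul_sum]
  refine (Finset.abs_sum_le_sum_abs _ _).trans (Finset.sum_le_sum fun i hi => ?_)
  rw [abs_mul]
  gcongr
  exact ha i (Finset.mem_range.1 hi)

/-- The quantisation error of a member of `lipClass`, in sup norm and tested against weights. -/
lemma exists_netFun_approx {f : ℝ → ℝ} (hf : f ∈ lipClass) {B : ℝ} (hB : 0 < B) {N : ℕ}
    (hN : 0 < N) {γ δ : ℝ} (hγ : γ = 2 * B / N) (hδ : δ = γ / N) (T : ℕ) (x w : ℕ → ℝ)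
    (hx : ∀ t, |x t| ≤ B) :
    ∃ c : Fin (N + 1) × (Fin N → Fin 3),
      (∀ t, |f (x t) - netFun B δ γ c (x t)| ≤ 2 * γ) ∧
      |∑ t ∈ Finset.range T, w t * (f (x t) - netFun B δ γ c (x t))|
        ≤ δ * ∑ t ∈ Finset.range T, |w t|
          + δ * ∑ i ∈ Finset.range (N ^ 2), |∑ t ∈ Finset.range T, w t * blockStep B δ N i (x t)|
          + γ * ∑ k ∈ Finset.range (N + 1),
              |∑ t ∈ Finset.range T, w t * blockInd B δ N k (x t)| := by
  have hN' : (0 : ℝ) < N := by exact_mod_cast hN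
  have hγ0 : 0 < γ := by rw [hγ]; positivity
  have hδ0 : 0 < δ := by rw [hδ]; positivity
  have hγN : (N : ℝ) * γ = 2 * B := by rw [hγ]; field_simp
  have hδN : (N : ℝ) * δ = γ := by rw [hδ]; field_simp
  obtain ⟨c, hc⟩ := exists_netFun_close hf hγ0 hB.le (N := N) (by linarith)
  have hgrid : ∀ k : ℕ, -B + ((k * N : ℕ) : ℝ) * δ = -B + k * γ := fun k => by
    rw [← hδN]; push_cast; ring
  -- Equality occurs at the state `B`, which falls in block `N`; hence `N + 1` block indicators and
  -- paths with `N` increments.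
  have hj : ∀ t, gridIdx B δ (x t) ≤ N ^ 2 := fun t => by
    have h1 := gridIdx_le hδ0 (abs_le.1 (hx t)).1
    have h2 := (abs_le.1 (hx t)).2
    have h3 : (gridIdx B δ (x t) : ℝ) * δ ≤ (N : ℝ) ^ 2 * δ := by
      have : (N : ℝ) ^ 2 * δ = 2 * B := by rw [← hγN, ← hδN]; ring
      linarith
    have h4 := le_of_mul_le_mul_right h3 hδ0
    exact_mod_cast h4
  have hnN : N ^ 2 / N ≤ N := by rw [sq, Nat.mul_div_cancel _ hN]
  have hfu : ∀ t, |f (x t) - f (-B + gridIdx B δ (x t) * δ)| ≤ δ := fun t => by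
    refine (abs_sub_le_of_mem_lipClass hf _ _).trans ?_
    have h1 := gridIdx_le hδ0 (abs_le.1 (hx t)).1
    have h2 := lt_gridIdx_add_one (B := B) (z := x t) hδ0
    rw [abs_of_nonneg (by linarith)]
    linarith
  have hkN : ∀ t, gridIdx B δ (x t) / N ≤ N := fun t =>
    (Nat.div_le_div_right (hj t)).trans hnN
  refine ⟨c, fun t => ?_, ?_⟩
  · set j := gridIdx B δ (x t) with hjt
    have h1 : |f (x t) - f (-B + (j / N : ℕ) * γ)| ≤ γ := by
      refine (abs_sub_le_of_mem_lipClass hf _ _).trans ?_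
      have h1 := gridIdx_le hδ0 (abs_le.1 (hx t)).1
      have h2 := lt_gridIdx_add_one (B := B) (z := x t) hδ0
      rw [← hjt] at h1 h2
      have h3 : ((j / N * N : ℕ) : ℝ) ≤ j := by exact_mod_cast Nat.div_mul_le_self j N
      have h4 : (j : ℝ) + 1 ≤ ((j / N * N : ℕ) : ℝ) + N := by
        exact_mod_cast Nat.lt_div_mul_add hN
      have h5 := mul_le_mul_of_nonneg_right h3 hδ0.le
      have h6 := mul_le_mul_of_nonneg_right h4 hδ0.le
      have h7 := hgrid (j / N)
      rw [abs_of_nonneg (by linarith)]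
      linarith
    have h2 := hc (j / N) (hkN t)
    -- One `γ` comes from moving to the left end of the block, the other from rounding the value
    -- there.
    have h3 : f (x t) - netFun B δ γ c (x t) = (f (x t) - f (-B + (j / N : ℕ) * γ))
        + (f (-B + (j / N : ℕ) * γ) - γ * decodePath c (j / N)) := by
      rw [netFun, ← hjt]; ring
    rw [h3]
    exact (abs_add_le _ _).trans (by linarith)
  · simp_rw [fun t => sub_netFun_eq f B δ γ hN c (hj t) hnN, mul_add, Finset.sum_add_distrib]
    refine (abs_add_le _ _).trans (add_le_add ((abs_add_le _ _).trans (add_le_add ?_ ?_)) ?_)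
    · rw [Finset.mul_sum]
      refine (Finset.abs_sum_le_sum_abs _ _).trans (Finset.sum_le_sum fun t _ => ?_)
      rw [abs_mul, mul_comm]
      gcongr
      exact hfu t
    · refine abs_sum_mul_sum_le T (N ^ 2) w x _ (blockStep B δ N) fun i _ => ?_
      refine (abs_sub_le_of_mem_lipClass hf _ _).trans ?_
      rw [show -B + ((i + 1 : ℕ) : ℝ) * δ - (-B + i * δ) = δ by push_cast; ring,
        abs_of_pos hδ0]
    · refine abs_sum_mul_sum_le T (N + 1) w x _ (blockInd B δ N) fun k hk => ?_
      rw [hgrid k]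
      exact hc k (Nat.lt_succ_iff.1 hk)

/-! ### In-sample error of least squares -/

/-- Continuity in the point and measurability in the outcome give joint measurability, which is
needed to evaluate the estimator at a random state. -/
lemma measurable_uncurry_of_lipClass {Ω : Type*} {mΩ : MeasurableSpace Ω} {g : Ω → ℝ → ℝ}
    (hm : ∀ z, Measurable fun ω => g ω z) (hg : ∀ ω, g ω ∈ lipClass) :
    Measurable fun p : Ω × ℝ => g p.1 p.2 :=
  (measurable_uncurry_of_continuous_of_measurable (u := fun z ω => g ω z)
    (fun ω => (hg ω).2.2.continuous) hm).comp measurable_swap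

/-- The argument counts the codes: `N + 1` starts and `3 ^ N` increment words, at most `6 ^ N` in
all. The bound is linear in `N`, with no extra logarithm. -/
lemma log_card_net_le {N : ℕ} (hN : 0 < N) :
    Real.log (((N + 1) * 3 ^ N : ℕ) : ℝ) ≤ 2 * N := by
  have h1 : (((N + 1) * 3 ^ N : ℕ) : ℝ) ≤ 6 ^ N := by
    have : (N + 1) * 3 ^ N ≤ 6 ^ N := by
      calc (N + 1) * 3 ^ N ≤ 2 ^ N * 3 ^ N := Nat.mul_le_mul_right _ Nat.lt_two_pow_self
        _ = 6 ^ N := by rw [← mul_pow]; norm_num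
    exact_mod_cast this
  have h2 : Real.log 6 ≤ 2 := by
    rw [Real.log_le_iff_le_exp (by norm_num)]
    have h3 : Real.exp 2 = Real.exp 1 ^ 2 := by rw [← Real.exp_nat_mul]; norm_num
    have h4 := Real.exp_one_gt_d9
    rw [h3]; nlinarith
  calc _ ≤ Real.log (6 ^ N) := Real.log_le_log (by positivity) h1
    _ = N * Real.log 6 := Real.log_pow _ _
    _ ≤ N * 2 := by gcongr
    _ = 2 * N := mul_comm _ _

/-- Exponent of the offset supermartingale of a net function. -/
noncomputable def offsetExponent (v : ℝ) (T : ℕ) (g : ℝ → ℝ) (x w : ℕ → ℝ) : ℝ :=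
  ∑ t ∈ Finset.range T, (g (x t) * w t - g (x t) ^ 2 * v / 2)

/-- The basic inequality for least squares. -/
lemma sum_sq_le_of_empiricalLoss_le {T : ℕ} (hT : 1 ≤ T) {f fstar : ℝ → ℝ} {x w : ℕ → ℝ}
    (hstep : ∀ t, x (t + 1) = fstar (x t) + w t)
    (hloss : empiricalLoss T x f ≤ empiricalLoss T x fstar) :
    ∑ t ∈ Finset.range T, (f (x t) - fstar (x t)) ^ 2
      ≤ 2 * ∑ t ∈ Finset.range T, w t * (f (x t) - fstar (x t)) := by
  have hT' : (0 : ℝ) < 1 / T := by positivity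
  have h1 := le_of_mul_le_mul_left hloss hT'
  have h2 : ∑ t ∈ Finset.range T, |x (t + 1) - f (x t)| ^ 2
      = ∑ t ∈ Finset.range T, |x (t + 1) - fstar (x t)| ^ 2
        - 2 * ∑ t ∈ Finset.range T, w t * (f (x t) - fstar (x t))
        + ∑ t ∈ Finset.range T, (f (x t) - fstar (x t)) ^ 2 := by
    rw [Finset.mul_sum, ← Finset.sum_sub_distrib, ← Finset.sum_add_distrib]
    refine Finset.sum_congr rfl fun t _ => ?_
    rw [sq_abs, sq_abs, hstep]; ring
  linarith

/-- A pathwise bound. The basic inequality is doubled, so that one copy of the squared error stays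
on the left and the other, moved to the right, becomes the quadratic offset of the net function. The
right side is linear in quantities whose means are controlled. -/
lemma sum_sq_le_of_lse {T : ℕ} (hT : 1 ≤ T) {f fstar : ℝ → ℝ} {x w : ℕ → ℝ} {v B γ δ : ℝ}
    (hv : 0 < v) (hB : 0 < B) {N : ℕ} (hN : 0 < N) (hγ : γ = 2 * B / N) (hδ : δ = γ / N)
    (hf : f ∈ lipClass) (hstep : ∀ t, x (t + 1) = fstar (x t) + w t)
    (hloss : empiricalLoss T x f ≤ empiricalLoss T x fstar)
    (hx : ∀ t, |x t| ≤ B) (hw : ∀ t, |w t| ≤ 2 * B) :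
    ∑ t ∈ Finset.range T, (f (x t) - fstar (x t)) ^ 2
      ≤ 8 * γ ^ 2 * T
        + 4 * δ * ∑ i ∈ Finset.range (N ^ 2), |∑ t ∈ Finset.range T, w t * blockStep B δ N i (x t)|
        + 4 * γ * ∑ k ∈ Finset.range (N + 1), |∑ t ∈ Finset.range T, w t * blockInd B δ N k (x t)|
        + 16 * v * (2 * N + (∑ c : Fin (N + 1) × (Fin N → Fin 3), Real.exp (offsetExponent v T
            (fun z => (netFun B δ γ c z - fstar z) / (4 * v)) x w))
              / ((N + 1) * 3 ^ N : ℕ) - 1) := by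
  obtain ⟨c, hc1, hc2⟩ := exists_netFun_approx hf hB hN hγ hδ T x w hx
  set G : Fin (N + 1) × (Fin N → Fin 3) → ℝ := fun c => offsetExponent v T
    (fun z => (netFun B δ γ c z - fstar z) / (4 * v)) x w with hG
  set n : ℝ := (((N + 1) * 3 ^ N : ℕ) : ℝ) with hn
  have hn0 : 0 < n := by rw [hn]; positivity
  set Y := ∑ c, Real.exp (G c) with hY
  have hGY : Real.exp (G c) ≤ Y :=
    Finset.single_le_sum (f := fun c => Real.exp (G c)) (fun c _ => (Real.exp_pos _).le)
      (Finset.mem_univ c)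
  have hY0 : 0 < Y := (Real.exp_pos _).trans_le hGY
  -- One exponent is at most the log of the sum over the net; `log (Y/n) ≤ Y/n - 1` then makes the
  -- bound linear in `Y`, so only the mean of `Y` matters.
  have hG1 : G c ≤ 2 * N + Y / n - 1 := by
    have h1 : G c ≤ Real.log Y := (Real.le_log_iff_exp_le hY0).2 hGY
    have h2 := Real.log_le_sub_one_of_pos (div_pos hY0 hn0)
    rw [Real.log_div hY0.ne' hn0.ne'] at h2
    have h3 := log_card_net_le hN
    rw [← hn] at h3
    linarith
  have hbasic := sum_sq_le_of_empiricalLoss_le hT hstep hloss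
  have hsplit : ∑ t ∈ Finset.range T, w t * (f (x t) - fstar (x t))
      = ∑ t ∈ Finset.range T, w t * (f (x t) - netFun B δ γ c (x t))
        + ∑ t ∈ Finset.range T, w t * (netFun B δ γ c (x t) - fstar (x t)) := by
    rw [← Finset.sum_add_distrib]
    exact Finset.sum_congr rfl fun t _ => by ring
  -- The tilt `1/(4v)` is chosen so that the offset is exactly half a square.
  have hoff : 4 * ∑ t ∈ Finset.range T, w t * (netFun B δ γ c (x t) - fstar (x t))
      - ∑ t ∈ Finset.range T, (netFun B δ γ c (x t) - fstar (x t)) ^ 2 / 2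
      = 16 * v * G c := by
    rw [hG]
    simp only [offsetExponent]
    rw [Finset.mul_sum, Finset.mul_sum, ← Finset.sum_sub_distrib]
    refine Finset.sum_congr rfl fun t _ => ?_
    field_simp
    ring
  -- From `(p + q)² / 2 ≤ p² + q²` with `|q| ≤ 2γ`.
  have hsq : ∑ t ∈ Finset.range T, (netFun B δ γ c (x t) - fstar (x t)) ^ 2 / 2
      ≤ ∑ t ∈ Finset.range T, (f (x t) - fstar (x t)) ^ 2 + 4 * γ ^ 2 * T := by
    have : ∑ t ∈ Finset.range T, (4 * γ ^ 2) = 4 * γ ^ 2 * T := by simp; ring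
    rw [← this, ← Finset.sum_add_distrib]
    refine Finset.sum_le_sum fun t _ => ?_
    have h1 := abs_le.1 (hc1 t)
    have h2 : (f (x t) - netFun B δ γ c (x t)) ^ 2 ≤ 4 * γ ^ 2 := by nlinarith
    nlinarith [sq_nonneg ((netFun B δ γ c (x t) - fstar (x t))
      + 2 * (f (x t) - netFun B δ γ c (x t)))]
  have hδw : δ * ∑ t ∈ Finset.range T, |w t| ≤ γ ^ 2 * T := by
    have hN' : (0 : ℝ) < N := by exact_mod_cast hN
    have h1 : ∑ t ∈ Finset.range T, |w t| ≤ T * (2 * B) :=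
      (Finset.sum_le_sum fun t _ => hw t).trans (by simp)
    have hδ0 : 0 ≤ δ := by rw [hδ, hγ]; positivity
    calc δ * ∑ t ∈ Finset.range T, |w t| ≤ δ * (T * (2 * B)) := by gcongr
      _ = γ ^ 2 * T := by rw [hδ, hγ]; field_simp
  have h5 := (le_abs_self _).trans hc2
  have h6 := mul_le_mul_of_nonneg_left hG1 (by positivity : (0 : ℝ) ≤ 16 * v)
  linarith

/-- In-sample prediction error of the least squares estimator, at resolution `N`. -/
lemma integral_sum_sq_lse_le {Ω : Type*} {mΩ : MeasurableSpace Ω} {μ : Measure Ω}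
    [IsProbabilityMeasure μ] {𝓕 : Filtration ℕ mΩ} {v B : ℝ} {x w : ℕ → Ω → ℝ}
    (h : BoundedNoiseModel μ 𝓕 v (2 * B) x w) (hv : 0 < v) (hB : 0 < B)
    {fstar : ℝ → ℝ} (hfs : fstar ∈ lipClass)
    (hstep : ∀ t ω, x (t + 1) ω = fstar (x t ω) + w t ω) (hx : ∀ t ω, |x t ω| ≤ B)
    {T : ℕ} (hT : 1 ≤ T) {fhat : Ω → ℝ → ℝ} (hhat : IsLSE lipClass T x fhat)
    {N : ℕ} (hN : 0 < N) {γ : ℝ} (hγ : γ = 2 * B / N) :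
    ∫ ω, ∑ t ∈ Finset.range T, (fhat ω (x t ω) - fstar (x t ω)) ^ 2 ∂μ
      ≤ 8 * γ ^ 2 * T + 24 * γ * √(v * T * N) + 32 * v * N := by
  have hN' : (0 : ℝ) < N := by exact_mod_cast hN
  have hγ0 : 0 < γ := by rw [hγ]; positivity
  set δ := γ / N with hδ
  have hδ0 : 0 < δ := by positivity
  set n : ℝ := (((N + 1) * 3 ^ N : ℕ) : ℝ) with hn
  have hn0 : 0 < n := by rw [hn]; positivity
  set S1 : Ω → ℝ := fun ω => ∑ i ∈ Finset.range (N ^ 2),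
    |∑ t ∈ Finset.range T, w t ω * blockStep B δ N i (x t ω)| with hS1
  set S2 : Ω → ℝ := fun ω => ∑ k ∈ Finset.range (N + 1),
    |∑ t ∈ Finset.range T, w t ω * blockInd B δ N k (x t ω)| with hS2
  set E : Fin (N + 1) × (Fin N → Fin 3) → Ω → ℝ := fun c ω => Real.exp (offsetExponent v T
    (fun z => (netFun B δ γ c z - fstar z) / (4 * v)) (fun t => x t ω) (fun t => w t ω)) with hE
  have hxm := h.state_measurable
  have hwm := h.noise_measurable
  have hsum : ∀ {n : ℕ} {φ : ℕ → ℝ → ℝ}, (∀ i, Measurable (φ i)) → (∀ i z, |φ i z| ≤ 1) →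
      Integrable (fun ω => ∑ i ∈ Finset.range n,
        |∑ t ∈ Finset.range T, w t ω * φ i (x t ω)|) μ := by
    intro n φ hφ hφ1
    refine integrable_finsetSum _ fun i _ => Integrable.abs (integrable_finsetSum _ fun t _ => ?_)
    refine integrable_of_abs_le ((hwm t).mul ((hφ i).comp (hxm t))) (C := 2 * B * 1) fun ω => ?_
    rw [abs_mul]
    exact mul_le_mul (h.abs_noise_le t ω) (hφ1 _ _) (abs_nonneg _) (by positivity)
  have iS1 : Integrable S1 μ := hsum (measurable_blockStep B δ N) (abs_blockStep_le B δ N)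
  have iS2 : Integrable S2 μ := hsum (measurable_blockInd B δ N) (abs_blockInd_le B δ N)
  have hgm : ∀ c : Fin (N + 1) × (Fin N → Fin 3),
      Measurable fun z => (netFun B δ γ c z - fstar z) / (4 * v) := fun c =>
    ((measurable_netFun B δ γ c).sub hfs.2.2.continuous.measurable).div_const _
  have hgb : ∀ (c : Fin (N + 1) × (Fin N → Fin 3)) z,
      |(netFun B δ γ c z - fstar z) / (4 * v)| ≤ (γ * (2 * N) + 1) / (4 * v) := fun c z => by
    rw [abs_div, abs_of_pos (by positivity : 0 < 4 * v)]
    gcongr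
    refine (abs_sub _ _).trans (add_le_add (abs_netFun_le B δ hγ0.le c z) ?_)
    rw [abs_of_nonneg (hfs.1 z).1]; exact (hfs.1 z).2
  have hE1 : ∀ c, ∫ ω, E c ω ∂μ ≤ 1 := fun c => h.integral_exp_sum_le_one (hgm c) (hgb c) T
  have iE : ∀ c, Integrable (E c) μ := fun c => by
    refine integrable_of_abs_le (C := Real.exp (T * ((γ * (2 * N) + 1) / (4 * v) * (2 * B)))) ?_ ?_
    · refine (Finset.measurable_sum _ fun t _ => ?_).exp
      have hgx := (hgm c).comp (hxm t)
      exact (hgx.mul (hwm t)).sub (((hgx.pow_const 2).mul_const _).div_const _)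
    · intro ω
      rw [Real.abs_exp]
      apply Real.exp_le_exp.2
      refine (Finset.sum_le_sum fun t _ =>
        (?_ : _ ≤ (γ * (2 * N) + 1) / (4 * v) * (2 * B))).trans (by simp)
      have h1 : 0 ≤ ((netFun B δ γ c (x t ω) - fstar (x t ω)) / (4 * v)) ^ 2 * v / 2 := by
        positivity
      have h2 := le_abs_self ((netFun B δ γ c (x t ω) - fstar (x t ω)) / (4 * v) * w t ω)
      rw [abs_mul] at h2
      have h3 := mul_le_mul (hgb c (x t ω)) (h.abs_noise_le t ω) (abs_nonneg _)
        (by positivity)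
      linarith
  have iY : Integrable (fun ω => ∑ c, E c ω) μ := integrable_finsetSum _ fun c _ => iE c
  have hYint : ∫ ω, ∑ c, E c ω ∂μ ≤ n := by
    rw [integral_finsetSum _ fun c _ => iE c]
    refine (Finset.sum_le_sum fun c _ => hE1 c).trans ?_
    simp [hn]
  have hS1int : ∫ ω, S1 ω ∂μ ≤ √((N ^ 2 : ℕ) * (4 * v * (T * N))) :=
    h.integral_sum_abs_noise_le hv (measurable_blockStep B δ N) (abs_blockStep_le B δ N) _ T
      (sum_blockStep_sq_le B δ hN _)
  have hS2int : ∫ ω, S2 ω ∂μ ≤ √((N + 1 : ℕ) * (4 * v * (T * 1))) :=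
    h.integral_sum_abs_noise_le hv (measurable_blockInd B δ N) (abs_blockInd_le B δ N) _ T
      (sum_blockInd_sq_le B δ N _)
  have hfm := measurable_uncurry_of_lipClass hhat.measurable hhat.mem
  have iL : Integrable (fun ω => ∑ t ∈ Finset.range T,
      (fhat ω (x t ω) - fstar (x t ω)) ^ 2) μ := by
    refine integrable_finsetSum _ fun t _ => ?_
    refine integrable_of_abs_le (C := 1) (((hfm.comp (measurable_id.prodMk (hxm t))).sub
      (hfs.2.2.continuous.measurable.comp (hxm t))).pow_const 2) fun ω => ?_
    have h1 := (hhat.mem ω).1 (x t ω)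
    have h2 := hfs.1 (x t ω)
    rw [abs_pow]
    refine pow_le_one₀ (abs_nonneg _) ?_
    rw [abs_le]
    constructor <;> linarith [h1.1, h1.2, h2.1, h2.2]
  have iR1 : Integrable (fun ω => 8 * γ ^ 2 * T + 4 * δ * S1 ω) μ :=
    (integrable_const _).add (iS1.const_mul _)
  have iR2 : Integrable (fun ω => 8 * γ ^ 2 * T + 4 * δ * S1 ω + 4 * γ * S2 ω) μ :=
    iR1.add (iS2.const_mul _)
  have iR3 : Integrable (fun ω => 2 * N + (∑ c, E c ω) / n - 1) μ :=
    ((integrable_const _).add (iY.div_const n)).sub (integrable_const _)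
  have i4 : Integrable (fun ω => 2 * N + (∑ c, E c ω) / n) μ :=
    (integrable_const _).add (iY.div_const n)
  have hmain := integral_mono iL (iR2.add (iR3.const_mul (16 * v))) fun ω =>
    sum_sq_le_of_lse hT hv hB hN hγ hδ (hhat.mem ω) (fun t => hstep t ω)
      (hhat.isMinOn ω hfs) (fun t => hx t ω) (fun t => h.abs_noise_le t ω)
  refine hmain.trans ?_
  simp only [Pi.add_apply]
  rw [integral_add iR2 (iR3.const_mul _), integral_add iR1 (iS2.const_mul _),
    integral_add (integrable_const _) (iS1.const_mul _), integral_const_mul (4 * δ),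
    integral_const_mul (4 * γ), integral_const_mul (16 * v), integral_sub i4 (integrable_const _),
    integral_add (integrable_const _) (iY.div_const n), integral_div]
  simp only [integral_const, probReal_univ, one_smul]
  have h1 : (∫ ω, ∑ c, E c ω ∂μ) / n ≤ 1 := (div_le_one hn0).2 hYint
  -- There are `N²` functions with overlap `N`; the weight `δ = γ/N` cancels the factor `N` outside
  -- the root.
  have h2 : 4 * δ * ∫ ω, S1 ω ∂μ ≤ 8 * γ * √(v * T * N) := by
    have e : √((N ^ 2 : ℕ) * (4 * v * (T * N))) = 2 * N * √(v * T * N) := by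
      rw [show ((N ^ 2 : ℕ) : ℝ) * (4 * v * (T * N)) = (2 * N) ^ 2 * (v * T * N) by
        push_cast; ring, Real.sqrt_mul (by positivity), Real.sqrt_sq (by positivity)]
    rw [e] at hS1int
    calc 4 * δ * ∫ ω, S1 ω ∂μ ≤ 4 * δ * (2 * N * √(v * T * N)) := by gcongr
      _ = 8 * γ * √(v * T * N) := by rw [hδ]; field_simp; ring
  have h3 : 4 * γ * ∫ ω, S2 ω ∂μ ≤ 16 * γ * √(v * T * N) := by
    have e : √((N + 1 : ℕ) * (4 * v * (T * 1))) ≤ 4 * √(v * T * N) := by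
      rw [show 4 * √(v * T * N) = √(4 ^ 2 * (v * T * N)) by
        rw [Real.sqrt_mul (by positivity : (0 : ℝ) ≤ 4 ^ 2), Real.sqrt_sq (by positivity)]]
      apply Real.sqrt_le_sqrt
      have h4 : (1 : ℝ) ≤ N := by exact_mod_cast hN
      have h5 : 0 ≤ v * T := by positivity
      push_cast
      nlinarith
    calc 4 * γ * ∫ ω, S2 ω ∂μ ≤ 4 * γ * (4 * √(v * T * N)) := by
          gcongr; exact hS2int.trans e
      _ = 16 * γ * √(v * T * N) := by ring
  have h4 : 16 * v * (2 * N + (∫ ω, ∑ c, E c ω ∂μ) / n - 1) ≤ 16 * v * (2 * N) := by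
    gcongr; linarith
  linarith

/-! ### Ramps and the generalisation gap -/

/-- Ramp of height `γ` on cell `k` of the grid `-B + γ ℕ`. -/
noncomputable def ramp (B γ : ℝ) (k : ℕ) (z : ℝ) : ℝ := max 0 (min (z - (-B + k * γ)) γ)

lemma measurable_ramp (B γ : ℝ) (k : ℕ) : Measurable (ramp B γ k) := by
  unfold ramp; fun_prop

lemma abs_ramp_le (B : ℝ) {γ : ℝ} (hγ : 0 ≤ γ) (k : ℕ) (z : ℝ) : |ramp B γ k z| ≤ γ := by
  unfold ramp
  rw [abs_of_nonneg (le_max_left _ _)]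
  exact max_le hγ (min_le_right _ _)

lemma ramp_mono (B γ : ℝ) (k : ℕ) : Monotone (ramp B γ k) := fun y z h => by
  unfold ramp; gcongr

/-- Successive ramps climb one after another, so they stack into one long clipped ramp. -/
lemma sum_ramp (B : ℝ) {γ : ℝ} (hγ : 0 ≤ γ) (n : ℕ) (z : ℝ) :
    ∑ k ∈ Finset.range n, ramp B γ k z = max 0 (min (z + B) (n * γ)) := by
  induction n with
  | zero => simp
  | succ n ih =>
    rw [Finset.sum_range_succ, ih, ramp]
    have h : 0 ≤ (n : ℝ) * γ := by positivity
    push_cast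
    rw [add_mul, one_mul]
    rcases le_total (z + B) 0 with h1 | h1
    · rw [min_eq_left (by linarith), min_eq_left (by linarith), min_eq_left (by linarith),
        max_eq_left (by linarith), max_eq_left (by linarith)]
      simp
    · rcases le_total (z + B) (n * γ) with h2 | h2
      · rw [min_eq_left h2, min_eq_left (by linarith), min_eq_left (by linarith),
          max_eq_right h1, max_eq_left (by linarith)]
        simp
      · rw [min_eq_right h2, max_eq_right h]
        rcases le_total (z + B) (n * γ + γ) with h3 | h3
        · rw [min_eq_left (by linarith), min_eq_left h3, max_eq_right (by linarith),
            max_eq_right h1]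
          ring
        · rw [min_eq_right (by linarith), min_eq_right h3, max_eq_right hγ,
            max_eq_right (by linarith)]

/-- By monotonicity all differences have the same sign, so they add up to the increment of a single
clipped ramp. The absence of a factor `n` is what later makes the total variance independent of the
resolution. -/
lemma sum_abs_ramp_sub_le (B : ℝ) {γ : ℝ} (hγ : 0 ≤ γ) (n : ℕ) (y z : ℝ) :
    ∑ k ∈ Finset.range n, |ramp B γ k y - ramp B γ k z| ≤ |y - z| := by
  wlog h : z ≤ y generalizing y z
  · have := this z y (le_of_not_ge h)
    rw [abs_sub_comm y z]
    simpa [abs_sub_comm] using this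
  · have e : ∀ k ∈ Finset.range n, |ramp B γ k y - ramp B γ k z|
        = ramp B γ k y - ramp B γ k z := fun k _ =>
      abs_of_nonneg (sub_nonneg.2 (ramp_mono B γ k h))
    rw [Finset.sum_congr rfl e, Finset.sum_sub_distrib, sum_ramp B hγ, sum_ramp B hγ]
    calc _ ≤ |max 0 (min (y + B) (n * γ)) - max 0 (min (z + B) (n * γ))| := le_abs_self _
      _ ≤ |min (y + B) (n * γ) - min (z + B) (n * γ)| := by
        simpa using abs_max_sub_max_le_max 0 (min (y + B) (n * γ)) 0 (min (z + B) (n * γ))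
      _ ≤ |y - z| := by
        simpa using abs_min_sub_min_le_max (y + B) (n * γ) (z + B) (n * γ)

lemma ramp_grid (B : ℝ) {γ : ℝ} (hγ : 0 ≤ γ) (k j : ℕ) :
    ramp B γ k (-B + j * γ) = if k < j then γ else 0 := by
  unfold ramp
  have e : -B + j * γ - (-B + k * γ) = ((j : ℝ) - k) * γ := by ring
  rw [e]
  split_ifs with h
  · have h1 : (k : ℝ) + 1 ≤ j := by exact_mod_cast h
    rw [min_eq_right (by nlinarith), max_eq_right hγ]
  · have h1 : (j : ℝ) ≤ k := by exact_mod_cast not_lt.1 h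
    exact max_eq_left ((min_le_left _ _).trans (by nlinarith))

/-- Approximation of a `2`-Lipschitz function on `[-B, B]` by combinations of ramps. -/
lemma exists_ramp_approx {h : ℝ → ℝ} (hh : ∀ y z, |h y - h z| ≤ 2 * |y - z|) {B γ : ℝ}
    (hγ : 0 < γ) {N : ℕ} (hN : N * γ = 2 * B) :
    ∃ s : ℕ → ℝ, (∀ k, |s k| ≤ 2) ∧ ∀ z, |z| ≤ B →
      |h z - (h (-B) + ∑ k ∈ Finset.range N, s k * ramp B γ k z)| ≤ 4 * γ := by
  set s : ℕ → ℝ := fun k => (h (-B + (k + 1 : ℕ) * γ) - h (-B + k * γ)) / γ with hs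
  -- The coefficients are the slopes of the piecewise linear interpolant of `h` on the grid.
  have hs2 : ∀ k, |s k| ≤ 2 := fun k => by
    simp only [hs]
    rw [abs_div, abs_of_pos hγ, div_le_iff₀ hγ]
    refine (hh _ _).trans ?_
    rw [show -B + ((k + 1 : ℕ) : ℝ) * γ - (-B + k * γ) = γ by push_cast; ring, abs_of_pos hγ]
  refine ⟨s, hs2, fun z hz => ?_⟩
  set p : ℝ → ℝ := fun z => h (-B) + ∑ k ∈ Finset.range N, s k * ramp B γ k z with hp
  have hpl : ∀ y z, |p y - p z| ≤ 2 * |y - z| := fun y z => by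
    have e : p y - p z = ∑ k ∈ Finset.range N, s k * (ramp B γ k y - ramp B γ k z) := by
      simp only [hp, mul_sub, Finset.sum_sub_distrib]; ring
    rw [e]
    refine (Finset.abs_sum_le_sum_abs _ _).trans ?_
    refine (Finset.sum_le_sum fun k _ => (?_ : _ ≤ 2 * |ramp B γ k y - ramp B γ k z|)).trans ?_
    · rw [abs_mul]; gcongr; exact hs2 k
    · rw [← Finset.mul_sum]; gcongr; exact sum_abs_ramp_sub_le B hγ.le N y z
  set j := gridIdx B γ z with hj
  have h1 := gridIdx_le hγ (abs_le.1 hz).1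
  have h2 := lt_gridIdx_add_one (B := B) (z := z) hγ
  rw [← hj] at h1 h2
  have hjN : j ≤ N := by
    have h3 : (j : ℝ) * γ ≤ N * γ := by linarith [(abs_le.1 hz).2]
    exact_mod_cast le_of_mul_le_mul_right h3 hγ
  have hpj : p (-B + j * γ) = h (-B + j * γ) := by
    simp only [hp, ramp_grid B hγ.le, mul_ite, mul_zero]
    rw [← Finset.sum_filter]
    have e2 : (Finset.range N).filter (fun i => i < j) = Finset.range j := by
      ext i; simp; omega
    rw [e2, Finset.sum_congr rfl fun k _ => div_mul_cancel₀ _ hγ.ne',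
      Finset.sum_range_sub (fun k : ℕ => h (-B + k * γ))]
    simp
  -- The function and its interpolant are both 2-Lipschitz and agree at the grid point, so each
  -- contributes `2γ`.
  have hzj : |z - (-B + j * γ)| ≤ γ := by
    rw [abs_of_nonneg (by linarith)]; linarith
  have h3 := hh z (-B + j * γ)
  have h4 := hpl (-B + j * γ) z
  rw [hpj, abs_sub_comm (-B + j * γ) z] at h4
  calc |h z - p z| = |(h z - h (-B + j * γ)) + (h (-B + j * γ) - p z)| := by congr 1; ring
    _ ≤ _ := (abs_add_le _ _).trans (by linarith)

/-- Deviations of a `2`-Lipschitz function are controlled by the deviations of the ramps. -/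
lemma sum_integral_sub_le {Ω : Type*} {mΩ : MeasurableSpace Ω} {μ : Measure Ω}
    [IsProbabilityMeasure μ] {x : ℕ → Ω → ℝ} (hxm : ∀ t, Measurable (x t)) {B γ : ℝ}
    (hx : ∀ t ω, |x t ω| ≤ B) {h : ℝ → ℝ} (hh : ∀ y z, |h y - h z| ≤ 2 * |y - z|)
    (hhi : ∀ t, Integrable (fun ω => h (x t ω)) μ)
    (hγ : 0 < γ) {N : ℕ} (hN : N * γ = 2 * B) (T : ℕ) (ω : Ω) :
    ∑ t ∈ Finset.range T, ∫ ω', h (x t ω') ∂μ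
      ≤ ∑ t ∈ Finset.range T, h (x t ω) + 8 * γ * T
        + 2 * ∑ k ∈ Finset.range N, |∑ t ∈ Finset.range T, ramp B γ k (x t ω)
            - ∫ ω', ∑ t ∈ Finset.range T, ramp B γ k (x t ω') ∂μ| := by
  obtain ⟨s, hs, happ⟩ := exists_ramp_approx hh hγ hN
  have hri : ∀ k t, Integrable (fun ω => ramp B γ k (x t ω)) μ := fun k t =>
    integrable_of_abs_le ((measurable_ramp B γ k).comp (hxm t)) fun ω =>
      abs_ramp_le B hγ.le k (x t ω)
  have hsi : ∀ t, Integrable (fun ω => ∑ k ∈ Finset.range N, s k * ramp B γ k (x t ω)) μ :=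
    fun t => integrable_finsetSum _ fun k _ => (hri k t).const_mul _
  have h1 : ∀ t, ∫ ω', h (x t ω') ∂μ
      ≤ h (-B) + ∑ k ∈ Finset.range N, s k * (∫ ω', ramp B γ k (x t ω') ∂μ) + 4 * γ := fun t => by
    have i1 : Integrable
        (fun ω => h (-B) + ∑ k ∈ Finset.range N, s k * ramp B γ k (x t ω)) μ :=
      (integrable_const _).add (hsi t)
    have := integral_mono (hhi t) (i1.add (integrable_const (4 * γ))) fun ω' => by
      have := (abs_le.1 (happ (x t ω') (hx t ω'))).2
      simp only [Pi.add_apply]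
      linarith
    simp only [Pi.add_apply] at this
    rw [integral_add i1 (integrable_const _), integral_add (integrable_const _) (hsi t),
      integral_finsetSum _ fun k _ => (hri k t).const_mul _] at this
    simpa [integral_const_mul] using this
  have h2 : ∀ t, h (-B) + ∑ k ∈ Finset.range N, s k * ramp B γ k (x t ω) - 4 * γ
      ≤ h (x t ω) := fun t => by
    have := (abs_le.1 (happ (x t ω) (hx t ω))).1
    linarith
  -- The approximation error is paid twice, under the integral and at the sample; the constant `h
  -- (-B)` cancels.
  have h3 : ∀ t ∈ Finset.range T, ∫ ω', h (x t ω') ∂μ ≤ h (x t ω) + 8 * γ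
      - ∑ k ∈ Finset.range N, s k * (ramp B γ k (x t ω) - ∫ ω', ramp B γ k (x t ω') ∂μ) := by
    intro t _
    simp only [mul_sub, Finset.sum_sub_distrib]
    linarith [h1 t, h2 t]
  refine (Finset.sum_le_sum h3).trans ?_
  rw [Finset.sum_sub_distrib, Finset.sum_add_distrib, Finset.sum_comm]
  have h4 : -∑ k ∈ Finset.range N, ∑ t ∈ Finset.range T,
      s k * (ramp B γ k (x t ω) - ∫ ω', ramp B γ k (x t ω') ∂μ)
      ≤ 2 * ∑ k ∈ Finset.range N, |∑ t ∈ Finset.range T, ramp B γ k (x t ω)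
            - ∫ ω', ∑ t ∈ Finset.range T, ramp B γ k (x t ω') ∂μ| := by
    refine (neg_le_abs _).trans ((Finset.abs_sum_le_sum_abs _ _).trans ?_)
    rw [Finset.mul_sum]
    refine Finset.sum_le_sum fun k _ => ?_
    rw [← Finset.mul_sum, Finset.sum_sub_distrib,
      ← integral_finsetSum _ fun t _ => hri k t, abs_mul]
    gcongr
    exact hs k
  have h5 : ∑ t ∈ Finset.range T, 8 * γ = 8 * γ * T := by simp; ring
  linarith

/-! ### Costs to go and total variance along the chain -/

/-- Expected sum of `c` over `n` consecutive states, started from state `z` at time `t`. -/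
noncomputable def costToGo {Ω : Type*} {mΩ : MeasurableSpace Ω} (μ : Measure Ω) (f : ℝ → ℝ)
    (w : ℕ → Ω → ℝ) (c : ℝ → ℝ) : ℕ → ℕ → ℝ → ℝ
  | 0, _, _ => 0
  | n + 1, t, z => c z + ∫ ω, costToGo μ f w c n (t + 1) (f z + w t ω) ∂μ

section CostToGo

variable {Ω : Type*} {mΩ : MeasurableSpace Ω} {μ : Measure Ω} [IsProbabilityMeasure μ]
  {f : ℝ → ℝ} {w : ℕ → Ω → ℝ}

lemma measurable_costToGo (hf : Measurable f) (hw : ∀ t, Measurable (w t)) {c : ℝ → ℝ}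
    (hc : Measurable c) (n t : ℕ) : Measurable (costToGo μ f w c n t) := by
  induction n generalizing t with
  | zero => exact measurable_const
  | succ n ih =>
    refine hc.add ?_
    have h : Measurable fun p : ℝ × Ω => costToGo μ f w c n (t + 1) (f p.1 + w t p.2) :=
      (ih (t + 1)).comp ((hf.comp measurable_fst).add ((hw t).comp measurable_snd))
    exact h.stronglyMeasurable.integral_prod_right'.measurable

lemma abs_costToGo_le {c : ℝ → ℝ} {C : ℝ} (hc : ∀ z, |c z| ≤ C) (n t : ℕ) (z : ℝ) :
    |costToGo μ f w c n t z| ≤ n * C := by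
  induction n generalizing t z with
  | zero => simp [costToGo]
  | succ n ih =>
    have h := norm_integral_le_of_norm_le_const (μ := μ)
      (f := fun ω => costToGo μ f w c n (t + 1) (f z + w t ω))
      (Filter.Eventually.of_forall fun ω => ih (t + 1) (f z + w t ω))
    rw [Real.norm_eq_abs, probReal_univ, mul_one] at h
    rw [costToGo]
    refine (abs_add_le _ _).trans ?_
    push_cast
    linarith [hc z]

lemma integrable_costToGo (hf : Measurable f) (hw : ∀ t, Measurable (w t)) {c : ℝ → ℝ}
    (hc : Measurable c) {C : ℝ} (hC : ∀ z, |c z| ≤ C) (n t : ℕ) {Y : Ω → ℝ} (hY : Measurable Y) :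
    Integrable (fun ω => costToGo μ f w c n t (Y ω)) μ :=
  integrable_of_abs_le ((measurable_costToGo hf hw hc n t).comp hY) fun ω =>
    abs_costToGo_le hC n t (Y ω)

/-- The `ℓ¹`-Lipschitz property of a family of costs passes to the costs to go. -/
lemma sum_abs_costToGo_sub_le {L : ℝ} (hL1 : L < 1)
    (hf : ∀ y z, |f y - f z| ≤ L * |y - z|) (hfm : Measurable f) (hw : ∀ t, Measurable (w t))
    {c : ℕ → ℝ → ℝ} (hc : ∀ k, Measurable (c k)) {C : ℝ} (hC : ∀ k z, |c k z| ≤ C) {N : ℕ}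
    (hlip : ∀ y z, ∑ k ∈ Finset.range N, |c k y - c k z| ≤ |y - z|) (n t : ℕ) (y z : ℝ) :
    ∑ k ∈ Finset.range N, |costToGo μ f w (c k) n t y - costToGo μ f w (c k) n t z|
      ≤ |y - z| / (1 - L) := by
  have hL : 0 < 1 - L := by linarith
  induction n generalizing t y z with
  | zero => simp only [costToGo, sub_zero, abs_zero, Finset.sum_const_zero]; positivity
  | succ n ih =>
    have hi : ∀ k z, Integrable (fun ω => costToGo μ f w (c k) n (t + 1) (f z + w t ω)) μ :=
      fun k z => integrable_costToGo hfm hw (hc k) (hC k) n (t + 1) ((hw t).const_add _)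
    have hi2 : ∀ k, Integrable (fun ω => |costToGo μ f w (c k) n (t + 1) (f y + w t ω)
        - costToGo μ f w (c k) n (t + 1) (f z + w t ω)|) μ := fun k =>
      ((hi k y).sub (hi k z)).abs
    have h1 : ∀ k ∈ Finset.range N,
        |costToGo μ f w (c k) (n + 1) t y - costToGo μ f w (c k) (n + 1) t z|
        ≤ |c k y - c k z| + ∫ ω, |costToGo μ f w (c k) n (t + 1) (f y + w t ω)
            - costToGo μ f w (c k) n (t + 1) (f z + w t ω)| ∂μ := fun k _ => by
      rw [costToGo, costToGo, add_sub_add_comm, ← integral_sub (hi k y) (hi k z)]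
      exact (abs_add_le _ _).trans (add_le_add le_rfl abs_integral_le_integral_abs)
    refine (Finset.sum_le_sum h1).trans ?_
    rw [Finset.sum_add_distrib,
      ← integral_finsetSum _ fun k _ => hi2 k]
    -- Synchronous coupling: the same noise drives both states, so it cancels and the distance
    -- shrinks by `L`. The constant `1/(1-L)` is the fixed point of `r = 1 + L r`.
    have h2 : ∫ ω, ∑ k ∈ Finset.range N, |costToGo μ f w (c k) n (t + 1) (f y + w t ω)
            - costToGo μ f w (c k) n (t + 1) (f z + w t ω)| ∂μ ≤ L * |y - z| / (1 - L) := by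
      refine (integral_mono (integrable_finsetSum _ fun k _ => hi2 k)
        (integrable_const (L * |y - z| / (1 - L))) fun ω => ?_).trans (by simp)
      refine (ih (t + 1) _ _).trans ?_
      rw [add_sub_add_right_eq_sub]
      gcongr
      exact hf y z
    calc _ ≤ |y - z| + L * |y - z| / (1 - L) := add_le_add (hlip y z) h2
      _ = |y - z| / (1 - L) := by field_simp; ring

/-- Squared deviations of an `ℓ¹`-Lipschitz family from its mean. -/
lemma sum_sq_sub_integral_le {G : ℕ → ℝ → ℝ} (hG : ∀ k, Measurable (G k)) {C : ℝ}
    (hC : ∀ k z, |G k z| ≤ C) {N : ℕ} {R : ℝ} (hR : 0 ≤ R)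
    (hlip : ∀ y z, ∑ k ∈ Finset.range N, |G k y - G k z| ≤ R * |y - z|)
    {Y : Ω → ℝ} (hY : Measurable Y) {a r : ℝ} (ha : ∀ ω, |a - Y ω| ≤ r) :
    ∑ k ∈ Finset.range N, (G k a - ∫ ω, G k (Y ω) ∂μ) ^ 2 ≤ (R * r) ^ 2 := by
  have hi : ∀ k, Integrable (fun ω => G k (Y ω)) μ := fun k =>
    integrable_of_abs_le ((hG k).comp hY) fun ω => hC k (Y ω)
  have hi2 : ∀ k, Integrable (fun ω => |G k a - G k (Y ω)|) μ := fun k =>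
    ((integrable_const _).sub (hi k)).abs
  have h1 : ∀ k ∈ Finset.range N, |G k a - ∫ ω, G k (Y ω) ∂μ| ≤ ∫ ω, |G k a - G k (Y ω)| ∂μ :=
    fun k _ => by
      have : G k a - ∫ ω, G k (Y ω) ∂μ = ∫ ω, (G k a - G k (Y ω)) ∂μ := by
        rw [integral_sub (integrable_const _) (hi k)]; simp
      rw [this]
      exact abs_integral_le_integral_abs
  have h2 : ∑ k ∈ Finset.range N, |G k a - ∫ ω, G k (Y ω) ∂μ| ≤ R * r := by
    refine (Finset.sum_le_sum h1).trans ?_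
    rw [← integral_finsetSum _ fun k _ => hi2 k]
    refine (integral_mono (integrable_finsetSum _ fun k _ => hi2 k)
      (integrable_const (R * r)) fun ω => (hlip a (Y ω)).trans ?_).trans (by simp)
    gcongr
    exact ha ω
  -- The `ℓ²` norm is at most the `ℓ¹` norm, so the size of the family costs nothing.
  calc _ = ∑ k ∈ Finset.range N, |G k a - ∫ ω, G k (Y ω) ∂μ| ^ 2 := by simp_rw [sq_abs]
    _ ≤ (∑ k ∈ Finset.range N, |G k a - ∫ ω, G k (Y ω) ∂μ|) ^ 2 :=
      Finset.sum_sq_le_sq_sum_of_nonneg fun k _ => abs_nonneg _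
    _ ≤ (R * r) ^ 2 := by
      have := Finset.sum_nonneg fun k (_ : k ∈ Finset.range N) =>
        abs_nonneg (G k a - ∫ ω, G k (Y ω) ∂μ)
      gcongr

end CostToGo

/-- The mean minimises the quadratic risk, so a variance may be bounded with any centre, without
identifying it as the mean. -/
lemma integral_sq_sub_integral_le {Ω : Type*} {mΩ : MeasurableSpace Ω} {μ : Measure Ω}
    [IsProbabilityMeasure μ] {S : Ω → ℝ} (hS : Measurable S) {C : ℝ} (hC : ∀ ω, |S ω| ≤ C)
    (m : ℝ) : ∫ ω, (S ω - ∫ ω', S ω' ∂μ) ^ 2 ∂μ ≤ ∫ ω, (S ω - m) ^ 2 ∂μ := by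
  have i1 : Integrable S μ := integrable_of_abs_le hS hC
  have i2 : Integrable (fun ω => S ω ^ 2) μ :=
    integrable_of_abs_le (hS.pow_const 2) (C := C ^ 2) fun ω => by
      rw [abs_pow]; exact pow_le_pow_left₀ (abs_nonneg _) (hC ω) 2
  have e : ∀ a : ℝ, ∫ ω, (S ω - a) ^ 2 ∂μ = ∫ ω, S ω ^ 2 ∂μ - 2 * a * ∫ ω, S ω ∂μ + a ^ 2 := by
    intro a
    have h1 : ∀ ω, (S ω - a) ^ 2 = S ω ^ 2 - 2 * a * S ω + a ^ 2 := fun ω => by ring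
    have i3 : Integrable (fun ω => S ω ^ 2 - 2 * a * S ω) μ := i2.sub (i1.const_mul _)
    simp_rw [h1]
    rw [integral_add i3 (integrable_const _), integral_sub i2 (i1.const_mul _),
      integral_const_mul]
    simp
  rw [e, e]
  nlinarith [sq_nonneg (∫ ω, S ω ∂μ - m)]

namespace BoundedNoiseModel

variable {Ω : Type*} {mΩ : MeasurableSpace Ω} {μ : Measure Ω} [IsProbabilityMeasure μ]
  {𝓕 : Filtration ℕ mΩ} {v b : ℝ} {x w : ℕ → Ω → ℝ}

/-- Pythagoras for a one-step innovation. -/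
lemma integral_sq_add_innovation (h : BoundedNoiseModel μ 𝓕 v b x w) {f : ℝ → ℝ}
    (hf : Measurable f) {n : ℕ} {A : Ω → ℝ} (hA : Measurable[𝓕 n] A) {C : ℝ}
    (hAC : ∀ ω, |A ω| ≤ C) {H : ℝ → ℝ} (hH : Measurable H) {C' : ℝ} (hHC : ∀ z, |H z| ≤ C') :
    ∫ ω, (A ω + (H (f (x n ω) + w n ω) - ∫ ω', H (f (x n ω) + w n ω') ∂μ)) ^ 2 ∂μ
      = ∫ ω, A ω ^ 2 ∂μ
        + ∫ ω, (H (f (x n ω) + w n ω) - ∫ ω', H (f (x n ω) + w n ω') ∂μ) ^ 2 ∂μ := by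
  have hA' : Measurable A := hA.mono (𝓕.le _) le_rfl
  have hxm := h.state_measurable n
  have hwm := h.noise_measurable n
  have hHp : Measurable fun p : Ω × Ω => H (f (x n p.1) + w n p.2) :=
    hH.comp (((hf.comp hxm).comp measurable_fst).add (hwm.comp measurable_snd))
  set P : Ω → ℝ := fun ω => ∫ ω', H (f (x n ω) + w n ω') ∂μ with hP
  have hPm : Measurable P := hHp.stronglyMeasurable.integral_prod_right'.measurable
  have hPb : ∀ ω, |P ω| ≤ C' := fun ω => by
    have := norm_integral_le_of_norm_le_const (μ := μ)
      (f := fun ω' => H (f (x n ω) + w n ω'))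
      (Filter.Eventually.of_forall fun ω' => hHC (f (x n ω) + w n ω'))
    rwa [Real.norm_eq_abs, probReal_univ, mul_one] at this
  have hHm : Measurable fun ω => H (f (x n ω) + w n ω) := hH.comp ((hf.comp hxm).add hwm)
  set D : Ω → ℝ := fun ω => H (f (x n ω) + w n ω) - P ω with hD
  have hDm : Measurable D := hHm.sub hPm
  have hDb : ∀ ω, |D ω| ≤ C' + C' := fun ω =>
    (abs_sub _ _).trans (add_le_add (hHC _) (hPb ω))
  have bd : ∀ {u r U R : ℝ}, |u| ≤ U → |r| ≤ R → |u * r| ≤ U * R := fun {u r U R} h1 h2 => by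
    rw [abs_mul]; exact mul_le_mul h1 h2 (abs_nonneg _) ((abs_nonneg _).trans h1)
  have i1 : Integrable (fun ω => A ω * H (f (x n ω) + w n ω)) μ :=
    integrable_of_abs_le (hA'.mul hHm) fun ω => bd (hAC ω) (hHC _)
  have i2 : Integrable (fun ω => A ω * P ω) μ :=
    integrable_of_abs_le (hA'.mul hPm) fun ω => bd (hAC ω) (hPb ω)
  have i3 : Integrable (fun p : Ω × Ω => A p.1 * H (f (x n p.1) + w n p.2)) (μ.prod μ) :=
    integrable_of_abs_le ((hA'.comp measurable_fst).mul hHp) fun p => bd (hAC p.1) (hHC _)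
  -- Decoupling `w n` from the past shows that `P` acts as the conditional mean, which makes the
  -- innovation orthogonal to `A`.
  have e1 : ∫ ω, A ω * H (f (x n ω) + w n ω) ∂μ = ∫ ω, A ω * P ω ∂μ := by
    have := integral_prodMk_eq_of_indep (μ := μ) (𝓕.le n) (X := fun ω => (A ω, x n ω))
      (hA.prodMk (h.measurable_state n)) hwm (h.indep n)
      (Φ := fun q => q.1.1 * H (f q.1.2 + q.2)) (by fun_prop)
    simp only at this
    rw [this, integral_prod _ i3]
    simp_rw [integral_const_mul, hP]
  have e2 : ∫ ω, A ω * D ω ∂μ = 0 := by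
    simp only [hD, mul_sub]
    rw [integral_sub i1 i2, e1, sub_self]
  have i4 : Integrable (fun ω => A ω * D ω) μ :=
    integrable_of_abs_le (hA'.mul hDm) fun ω => bd (hAC ω) (hDb ω)
  have i5 : Integrable (fun ω => A ω ^ 2) μ := by
    simp_rw [sq]
    exact integrable_of_abs_le (hA'.mul hA') fun ω => bd (hAC ω) (hAC ω)
  have i6 : Integrable (fun ω => D ω ^ 2) μ := by
    simp_rw [sq]
    exact integrable_of_abs_le (hDm.mul hDm) fun ω => bd (hDb ω) (hDb ω)
  have e3 : ∀ ω, (A ω + D ω) ^ 2 = A ω ^ 2 + 2 * (A ω * D ω) + D ω ^ 2 := fun ω => by ring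
  have i7 : Integrable (fun ω => A ω ^ 2 + 2 * (A ω * D ω)) μ := i5.add (i4.const_mul 2)
  change ∫ ω, (A ω + D ω) ^ 2 ∂μ = ∫ ω, A ω ^ 2 ∂μ + ∫ ω, D ω ^ 2 ∂μ
  simp_rw [e3]
  rw [integral_add i7 i6, integral_add i5 (i4.const_mul 2), integral_const_mul, e2]
  ring

/-- Total variance of the empirical sums of an `ℓ¹`-Lipschitz family along a contractive chain. -/
lemma sum_variance_le (h : BoundedNoiseModel μ 𝓕 v b x w) {f : ℝ → ℝ} (hfm : Measurable f)
    {L : ℝ} (hL1 : L < 1) (hf : ∀ y z, |f y - f z| ≤ L * |y - z|)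
    (hstep : ∀ t ω, x (t + 1) ω = f (x t ω) + w t ω) (hx0 : ∀ ω, |x 0 ω| ≤ b)
    {c : ℕ → ℝ → ℝ} (hc : ∀ k, Measurable (c k)) {C : ℝ} (hC : ∀ k z, |c k z| ≤ C) {N : ℕ}
    (hlip : ∀ y z, ∑ k ∈ Finset.range N, |c k y - c k z| ≤ |y - z|) (T : ℕ) :
    ∑ k ∈ Finset.range N, ∫ ω, (∑ t ∈ Finset.range T, c k (x t ω)
        - ∫ ω', ∑ t ∈ Finset.range T, c k (x t ω') ∂μ) ^ 2 ∂μ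
      ≤ (T + 1) * (2 * b / (1 - L)) ^ 2 := by
  have hL : 0 < 1 - L := by linarith
  have hxm := h.state_measurable
  have hwm := h.noise_measurable
  set G : ℕ → ℕ → ℝ → ℝ := fun k n z => costToGo μ f w (c k) (T - n) n z with hG
  have hGm : ∀ k n, Measurable (G k n) := fun k n => measurable_costToGo hfm hwm (hc k) _ _
  have hC0 : 0 ≤ C := (abs_nonneg _).trans (hC 0 0)
  have hGb : ∀ k n z, |G k n z| ≤ T * C := fun k n z =>
    (abs_costToGo_le (hC k) _ _ z).trans (by gcongr; exact Nat.sub_le _ _)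
  have hGl : ∀ n y z, ∑ k ∈ Finset.range N, |G k n y - G k n z| ≤ (1 - L)⁻¹ * |y - z| :=
    fun n y z => (sum_abs_costToGo_sub_le hL1 hf hfm hwm hc hC hlip _ _ y z).trans
      (by rw [div_eq_inv_mul])
  have hdev : ∀ (n : ℕ) (Y : Ω → ℝ) (a : ℝ), Measurable Y → (∀ ω, |a - Y ω| ≤ 2 * b) →
      ∑ k ∈ Finset.range N, (G k n a - ∫ ω, G k n (Y ω) ∂μ) ^ 2 ≤ (2 * b / (1 - L)) ^ 2 :=
    fun n Y a hY ha => by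
      have := sum_sq_sub_integral_le (μ := μ) (G := fun k => G k n) (fun k => hGm k n)
        (fun k => hGb k n) (inv_nonneg.2 hL.le) (hGl n) hY ha
      rwa [← div_eq_inv_mul] at this
  set m : ℕ → ℝ := fun k => ∫ ω, G k 0 (x 0 ω) ∂μ with hm
  have habs2 : ∀ {p q : ℝ}, |p| ≤ b → |q| ≤ b → |p - q| ≤ 2 * b := fun {p q} hp hq =>
    (abs_sub _ _).trans (by linarith)
  have sqi : ∀ {Z : Ω → ℝ} {K : ℝ}, Measurable Z → (∀ ω, |Z ω| ≤ K) →
      Integrable (fun ω => Z ω ^ 2) μ := fun {Z K} hZ hK =>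
    integrable_of_abs_le (hZ.pow_const 2) (C := K ^ 2) fun ω => by
      rw [abs_pow]; exact pow_le_pow_left₀ (abs_nonneg _) (hK ω) 2
  have hmb : ∀ k, |m k| ≤ T * C := fun k => by
    have := norm_integral_le_of_norm_le_const (μ := μ) (f := fun ω => G k 0 (x 0 ω))
      (Filter.Eventually.of_forall fun ω => hGb k 0 (x 0 ω))
    rwa [Real.norm_eq_abs, probReal_univ, mul_one] at this
  -- The partial sum plus the cost to go is the Doob martingale of the full sum, and each innovation
  -- adds at most one unit of variance. The spread of the random initial state accounts for the `+
  -- 1`.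
  have key : ∀ n ≤ T, ∑ k ∈ Finset.range N,
      ∫ ω, (∑ t ∈ Finset.range n, c k (x t ω) + G k n (x n ω) - m k) ^ 2 ∂μ
      ≤ (n + 1) * (2 * b / (1 - L)) ^ 2 := by
    intro n
    induction n with
    | zero =>
      intro _
      simp only [Finset.range_zero, Finset.sum_empty, zero_add, Nat.cast_zero, one_mul]
      have hi : ∀ k, Integrable (fun ω => (G k 0 (x 0 ω) - m k) ^ 2) μ := fun k =>
        sqi (((hGm k 0).comp (hxm 0)).sub_const _) (K := T * C + T * C) fun ω =>
          (abs_sub _ _).trans (add_le_add (hGb _ _ _) (hmb k))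
      rw [← integral_finsetSum _ fun k _ => hi k]
      refine (integral_mono (integrable_finsetSum _ fun k _ => hi k)
        (integrable_const ((2 * b / (1 - L)) ^ 2)) fun ω => ?_).trans (by simp)
      exact hdev 0 (x 0) (x 0 ω) (hxm 0) fun ω' => habs2 (hx0 ω) (hx0 ω')
    | succ n ih =>
      intro hn
      have ih' := ih (by omega)
      have hP : ∀ k z, G k n z = c k z + ∫ ω', G k (n + 1) (f z + w n ω') ∂μ := fun k z => by
        simp only [hG]
        rw [show T - n = (T - (n + 1)) + 1 by omega, costToGo]
      have e1 : ∀ k ω, ∑ t ∈ Finset.range (n + 1), c k (x t ω) + G k (n + 1) (x (n + 1) ω) - m k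
          = (∑ t ∈ Finset.range n, c k (x t ω) + G k n (x n ω) - m k)
            + (G k (n + 1) (f (x n ω) + w n ω)
              - ∫ ω', G k (n + 1) (f (x n ω) + w n ω') ∂μ) := fun k ω => by
        rw [Finset.sum_range_succ, hP k (x n ω), hstep]; ring
      have hAm : ∀ k, Measurable[𝓕 n]
          fun ω => ∑ t ∈ Finset.range n, c k (x t ω) + G k n (x n ω) - m k := fun k => by
        refine Measurable.sub_const (Measurable.add (Finset.measurable_sum _ fun t ht => ?_)
          ((hGm k n).comp (h.measurable_state n))) _
        exact (hc k).comp ((h.measurable_state t).mono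
          (𝓕.mono (Finset.mem_range.1 ht).le) le_rfl)
      have hAb : ∀ k ω, |∑ t ∈ Finset.range n, c k (x t ω) + G k n (x n ω) - m k|
          ≤ n * C + T * C + T * C := fun k ω => by
        refine (abs_sub _ _).trans (add_le_add ((abs_add_le _ _).trans
          (add_le_add ?_ (hGb _ _ _))) (hmb k))
        exact (Finset.abs_sum_le_sum_abs _ _).trans
          ((Finset.sum_le_sum fun t _ => hC k _).trans (by simp))
      have e2 : ∀ k, ∫ ω, (∑ t ∈ Finset.range (n + 1), c k (x t ω)
          + G k (n + 1) (x (n + 1) ω) - m k) ^ 2 ∂μ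
          = ∫ ω, (∑ t ∈ Finset.range n, c k (x t ω) + G k n (x n ω) - m k) ^ 2 ∂μ
            + ∫ ω, (G k (n + 1) (f (x n ω) + w n ω)
              - ∫ ω', G k (n + 1) (f (x n ω) + w n ω') ∂μ) ^ 2 ∂μ := fun k => by
        simp_rw [e1]
        exact h.integral_sq_add_innovation hfm (hAm k) (hAb k) (hGm k (n + 1)) (hGb k (n + 1))
      rw [Finset.sum_congr rfl fun k _ => e2 k, Finset.sum_add_distrib]
      have hPm : ∀ k, Measurable fun ω => ∫ ω', G k (n + 1) (f (x n ω) + w n ω') ∂μ := fun k => by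
        have : Measurable fun p : Ω × Ω => G k (n + 1) (f (x n p.1) + w n p.2) :=
          (hGm k _).comp (((hfm.comp (hxm n)).comp measurable_fst).add
            ((hwm n).comp measurable_snd))
        exact this.stronglyMeasurable.integral_prod_right'.measurable
      have hi : ∀ k, Integrable (fun ω => (G k (n + 1) (f (x n ω) + w n ω)
              - ∫ ω', G k (n + 1) (f (x n ω) + w n ω') ∂μ) ^ 2) μ := fun k => by
        refine sqi (((hGm k _).comp ((hfm.comp (hxm n)).add (hwm n))).sub (hPm k))
          (K := T * C + T * C) fun ω => (abs_sub _ _).trans (add_le_add (hGb _ _ _) ?_)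
        have := norm_integral_le_of_norm_le_const (μ := μ)
          (f := fun ω' => G k (n + 1) (f (x n ω) + w n ω'))
          (Filter.Eventually.of_forall fun ω' => hGb k (n + 1) (f (x n ω) + w n ω'))
        rwa [Real.norm_eq_abs, probReal_univ, mul_one] at this
      have h2 : ∑ k ∈ Finset.range N, ∫ ω, (G k (n + 1) (f (x n ω) + w n ω)
              - ∫ ω', G k (n + 1) (f (x n ω) + w n ω') ∂μ) ^ 2 ∂μ ≤ (2 * b / (1 - L)) ^ 2 := by
        rw [← integral_finsetSum _ fun k _ => hi k]
        refine (integral_mono (integrable_finsetSum _ fun k _ => hi k)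
          (integrable_const ((2 * b / (1 - L)) ^ 2)) fun ω => ?_).trans (by simp)
        refine hdev (n + 1) (fun ω' => f (x n ω) + w n ω') _ ((hwm n).const_add _) fun ω' => ?_
        rw [add_sub_add_left_eq_sub]
        exact habs2 (h.abs_noise_le n ω) (h.abs_noise_le n ω')
      push_cast
      linarith
  refine le_trans (Finset.sum_le_sum fun k _ => ?_) (key T le_rfl)
  have hGT : ∀ k ω, G k T (x T ω) = 0 := fun k ω => by
    simp only [hG, Nat.sub_self, costToGo]
  simp only [hGT, add_zero]
  exact integral_sq_sub_integral_le (Finset.measurable_sum _ fun t _ => (hc k).comp (hxm t))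
    (C := T * C) (fun ω => (Finset.abs_sum_le_sum_abs _ _).trans
      ((Finset.sum_le_sum fun t _ => hC k _).trans (by simp))) (m k)

end BoundedNoiseModel

/-! ### Reduction to the bounded model and bounds on the class -/

/-- The noise is a difference of two quantities bounded by `B`, and the conditional moment bounds
integrate to unconditional ones. Allowing `v` above `σ²` leaves room for a positive `v` when `σ =
0`. -/
lemma IsAutoregressive.boundedNoiseModel {Ω : Type*} {mΩ : MeasurableSpace Ω} {μ : Measure Ω}
    [IsProbabilityMeasure μ] {𝓕 : Filtration ℕ mΩ} {f : ℝ → ℝ} {σ B v : ℝ} {x w : ℕ → Ω → ℝ}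
    (h : IsAutoregressive μ 𝓕 f σ x w) (hf : f ∈ lipClass)
    (hind : ∀ t, Indep (MeasurableSpace.comap (w t) inferInstance) (𝓕 t) μ)
    (hx : ∀ t ω, |x t ω| ≤ B) (hv : σ ^ 2 ≤ v) : BoundedNoiseModel μ 𝓕 v (2 * B) x w where
  measurable_state := h.measurable_state
  measurable_noise := h.measurable_noise
  indep := hind
  abs_noise_le t ω := by
    have h1 : w t ω = x (t + 1) ω - f (x t ω) := by rw [h.step]; ring
    rw [h1]
    refine (abs_sub _ _).trans ?_
    linarith [hx (t + 1) ω, hx t ω, abs_le_of_mem_lipClass hf (x t ω)]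
  integral_noise t := by
    rw [← integral_condExp (𝓕.le t), integral_congr_ae (h.condExp_noise t)]
    simp
  mgf_le t s := by
    obtain ⟨_, h2⟩ := h.subgaussian_noise t s
    have h3 : ∫ ω, Real.exp (s * w t ω) ∂μ
        = ∫ ω, Real.exp (s * (w t ω - (μ[w t | 𝓕 t]) ω)) ∂μ := by
      refine integral_congr_ae ?_
      filter_upwards [h.condExp_noise t] with ω hω
      rw [hω]; simp
    rw [h3, ← integral_condExp (𝓕.le t)]
    refine (integral_mono_ae integrable_condExp (integrable_const _) h2).trans ?_
    simp only [integral_const, probReal_univ, one_smul]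
    gcongr

/-- Integrals against the mixture law are averages. -/
lemma integral_mixtureLaw {Ω : Type*} {mΩ : MeasurableSpace Ω} {μ : Measure Ω}
    [IsProbabilityMeasure μ] {x : ℕ → Ω → ℝ} (hx : ∀ t, Measurable (x t)) (T : ℕ) {h : ℝ → ℝ}
    (hm : Measurable h) {C : ℝ} (hC : ∀ z, |h z| ≤ C) :
    ∫ z, h z ∂(mixtureLaw μ x T) = (T : ℝ)⁻¹ * ∑ t ∈ Finset.range T, ∫ ω, h (x t ω) ∂μ := by
  have : ∀ t, IsProbabilityMeasure (μ.map (x t)) := fun t =>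
    Measure.isProbabilityMeasure_map (hx t).aemeasurable
  rw [mixtureLaw, integral_smul_measure,
    integral_finsetSum_measure fun t _ => integrable_of_abs_le hm hC]
  simp only [ENNReal.toReal_inv, ENNReal.toReal_natCast, smul_eq_mul]
  congr 1
  exact Finset.sum_congr rfl fun t _ => integral_map (hx t).aemeasurable hm.aestronglyMeasurable

lemma isFiniteMeasure_mixtureLaw {Ω : Type*} {mΩ : MeasurableSpace Ω} (μ : Measure Ω)
    [IsProbabilityMeasure μ] (x : ℕ → Ω → ℝ) {T : ℕ} (hT : 1 ≤ T) :
    IsFiniteMeasure (mixtureLaw μ x T) := by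
  have : IsFiniteMeasure (∑ t ∈ Finset.range T, μ.map (x t)) := by
    refine ⟨?_⟩
    rw [Measure.finsetSum_apply]
    exact ENNReal.sum_lt_top.2 fun t _ => measure_lt_top _ _
  exact Measure.smul_finite _ (by simp; omega)

/-- Places the pointwise error of any estimate within reach of the ramp approximation. -/
lemma abs_abs_sub_sub_le {f g : ℝ → ℝ} (hf : f ∈ lipClass) (hg : g ∈ lipClass) (y z : ℝ) :
    |(|f y - g y|) - (|f z - g z|)| ≤ 2 * |y - z| := by
  refine (abs_abs_sub_abs_le _ _).trans ?_
  have h1 := abs_sub_le_of_mem_lipClass hf y z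
  have h2 := abs_sub_le_of_mem_lipClass hg y z
  calc |f y - g y - (f z - g z)| = |(f y - f z) - (g y - g z)| := by congr 1; ring
    _ ≤ |f y - f z| + |g y - g z| := abs_sub _ _
    _ ≤ _ := by linarith

lemma abs_sub_le_one_of_mem_lipClass {f g : ℝ → ℝ} (hf : f ∈ lipClass) (hg : g ∈ lipClass)
    (z : ℝ) : |f z - g z| ≤ 1 := by
  have h1 := hf.1 z
  have h2 := hg.1 z
  rw [abs_le]
  constructor <;> linarith [h1.1, h1.2, h2.1, h2.2]

/-- Both values lie in `[0, B]`, hence `B` rather than `2B`. -/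
lemma abs_sub_le_bound_of_mem_lipClass {f g : ℝ → ℝ} (hf : f ∈ lipClass) (hg : g ∈ lipClass)
    {z B : ℝ} (hz : |z| ≤ B) : |f z - g z| ≤ B := by
  have h1 := (abs_le.1 ((abs_le_of_mem_lipClass hf z).trans hz)).2
  have h2 := (abs_le.1 ((abs_le_of_mem_lipClass hg z).trans hz)).2
  rw [abs_le]
  constructor <;> linarith [(hf.1 z).1, (hg.1 z).1]

/-! ### Choice of resolutions and conclusion -/

/-- In-sample error with the resolution optimised: `a³ = v B / T`. -/
lemma integral_sum_abs_lse_le {Ω : Type*} {mΩ : MeasurableSpace Ω} {μ : Measure Ω}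
    [IsProbabilityMeasure μ] {𝓕 : Filtration ℕ mΩ} {v B a : ℝ} {x w : ℕ → Ω → ℝ}
    (h : BoundedNoiseModel μ 𝓕 v (2 * B) x w) (hv : 0 < v) (hB : 0 < B)
    {fstar : ℝ → ℝ} (hfs : fstar ∈ lipClass)
    (hstep : ∀ t ω, x (t + 1) ω = fstar (x t ω) + w t ω) (hx : ∀ t ω, |x t ω| ≤ B)
    {T : ℕ} (hT : 1 ≤ T) {fhat : Ω → ℝ → ℝ} (hhat : IsLSE lipClass T x fhat)
    (ha : 0 < a) (haB : a ≤ B) (ha3 : a ^ 3 * T = v * B) :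
    ∫ ω, ∑ t ∈ Finset.range T, |fhat ω (x t ω) - fstar (x t ω)| ∂μ ≤ 14 * a * T := by
  have hT' : (0 : ℝ) < T := by exact_mod_cast hT
  set N := ⌈B / a⌉₊ with hN
  have h1 : 1 ≤ B / a := (one_le_div ha).2 haB
  have hN0 : 0 < N := Nat.ceil_pos.2 (by linarith)
  have hN1 : B / a ≤ N := Nat.le_ceil _
  have hN2 : (N : ℝ) ≤ 2 * (B / a) := by
    have := Nat.ceil_lt_add_one (by linarith : 0 ≤ B / a)
    rw [← hN] at this
    linarith
  have hN' : (0 : ℝ) < N := by exact_mod_cast hN0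
  have hfm := measurable_uncurry_of_lipClass hhat.measurable hhat.mem
  have hgm : ∀ t, Measurable fun ω => fhat ω (x t ω) - fstar (x t ω) := fun t =>
    (hfm.comp (measurable_id.prodMk (h.state_measurable t))).sub
      (hfs.2.2.continuous.measurable.comp (h.state_measurable t))
  have hgb : ∀ t ω, |fhat ω (x t ω) - fstar (x t ω)| ≤ 1 := fun t ω =>
    abs_sub_le_one_of_mem_lipClass (hhat.mem ω) hfs _
  have key := integral_sum_sq_lse_le h hv hB hfs hstep hx hT hhat hN0 (γ := 2 * B / N) rfl
  set γ := 2 * B / N with hγ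
  have hγ0 : 0 < γ := by positivity
  have hγa : γ ≤ 2 * a := by
    rw [hγ, div_le_iff₀ hN']
    rw [div_le_iff₀ ha] at hN1
    linarith
  have hvN : v * N ≤ 2 * a ^ 2 * T := by
    calc v * N ≤ v * (2 * (B / a)) := by gcongr
      _ = 2 * (v * B) / a := by ring
      _ = 2 * a ^ 2 * T := by rw [← ha3]; field_simp
  have hsqrt : √(v * T * N) ≤ 2 * a * T := by
    apply Real.sqrt_le_iff.2 ⟨by positivity, ?_⟩
    have := mul_le_mul_of_nonneg_right hvN hT'.le
    nlinarith [sq_nonneg (a * T)]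
  have h5 : 24 * γ * √(v * T * N) ≤ 24 * (2 * a) * (2 * a * T) := by gcongr
  have h6 : 8 * γ ^ 2 * T ≤ 8 * (2 * a) ^ 2 * T := by gcongr
  -- The three terms give `32 + 96 + 64 = 192`, rounded up to `14²`.
  have hV : ∫ ω, ∑ t ∈ Finset.range T, (fhat ω (x t ω) - fstar (x t ω)) ^ 2 ∂μ
      ≤ 196 * a ^ 2 * T := by
    have : 0 ≤ a ^ 2 * T := by positivity
    linarith
  have hi : ∀ t, Integrable (fun ω => (fhat ω (x t ω) - fstar (x t ω)) ^ 2) μ := fun t =>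
    integrable_of_abs_le ((hgm t).pow_const 2) (C := 1) fun ω => by
      rw [abs_pow]; exact pow_le_one₀ (abs_nonneg _) (hgb t ω)
  rw [integral_finsetSum _ fun t _ => hi t] at hV
  refine (integral_sum_abs_le_sqrt _ hgm hgb hV).trans ?_
  rw [Finset.card_range, Real.sqrt_le_left (by positivity)]
  exact le_of_eq (by ring)

/-- Uniform deviations of the ramps at the optimised resolution: `ρ³ = (1 - L)² T`. -/
lemma integral_sum_abs_ramp_dev_le {Ω : Type*} {mΩ : MeasurableSpace Ω} {μ : Measure Ω}
    [IsProbabilityMeasure μ] {𝓕 : Filtration ℕ mΩ} {v B L ρ : ℝ} {x w : ℕ → Ω → ℝ}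
    (h : BoundedNoiseModel μ 𝓕 v (2 * B) x w) (hB : 0 < B) {f : ℝ → ℝ} (hfm : Measurable f)
    (hL1 : L < 1) (hf : ∀ y z, |f y - f z| ≤ L * |y - z|)
    (hstep : ∀ t ω, x (t + 1) ω = f (x t ω) + w t ω) (hx : ∀ t ω, |x t ω| ≤ B)
    {T : ℕ} (hT : 1 ≤ T) (hρ : 0 < ρ) (hρ3 : ρ ^ 3 = (1 - L) ^ 2 * T) {N : ℕ}
    (hN : (N : ℝ) ≤ 2 * ρ) {γ : ℝ} (hγ : 0 ≤ γ) :
    ∫ ω, ∑ k ∈ Finset.range N, |∑ t ∈ Finset.range T, ramp B γ k (x t ω)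
        - ∫ ω', ∑ t ∈ Finset.range T, ramp B γ k (x t ω') ∂μ| ∂μ ≤ 8 * (B / ρ) * T := by
  have hL : 0 < 1 - L := by linarith
  have hT' : (1 : ℝ) ≤ T := by exact_mod_cast hT
  have hV := h.sum_variance_le hfm hL1 hf hstep (fun ω => (hx 0 ω).trans (by linarith))
    (measurable_ramp B γ) (abs_ramp_le B hγ) (sum_abs_ramp_sub_le B hγ N) T
  have hSm : ∀ k, Measurable fun ω => ∑ t ∈ Finset.range T, ramp B γ k (x t ω) := fun k =>
    Finset.measurable_sum _ fun t _ => (measurable_ramp B γ k).comp (h.state_measurable t)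
  have hSb : ∀ k ω, |∑ t ∈ Finset.range T, ramp B γ k (x t ω)| ≤ T * γ := fun k ω =>
    (Finset.abs_sum_le_sum_abs _ _).trans
      ((Finset.sum_le_sum fun t _ => abs_ramp_le B hγ k _).trans (by simp))
  have hb : ∀ k ω, |∑ t ∈ Finset.range T, ramp B γ k (x t ω)
      - ∫ ω', ∑ t ∈ Finset.range T, ramp B γ k (x t ω') ∂μ| ≤ T * γ + T * γ := fun k ω => by
    refine (abs_sub _ _).trans (add_le_add (hSb k ω) ?_)
    have := norm_integral_le_of_norm_le_const (μ := μ)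
      (f := fun ω => ∑ t ∈ Finset.range T, ramp B γ k (x t ω))
      (Filter.Eventually.of_forall (hSb k))
    rwa [Real.norm_eq_abs, probReal_univ, mul_one] at this
  refine (integral_sum_abs_le_sqrt _ (fun k => (hSm k).sub_const _) hb hV).trans ?_
  rw [Finset.card_range, Real.sqrt_le_left (by positivity)]
  calc (N : ℝ) * ((T + 1) * (2 * (2 * B) / (1 - L)) ^ 2)
      ≤ (2 * ρ) * ((2 * T) * (2 * (2 * B) / (1 - L)) ^ 2) := by gcongr; linarith
    _ = 64 * B ^ 2 * T * (ρ ^ 3) / (ρ ^ 2 * (1 - L) ^ 2) := by field_simp; ring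
    _ = (8 * (B / ρ) * T) ^ 2 := by rw [hρ3]; field_simp; ring

/-- Out-of-sample error in terms of the two resolutions. -/
lemma sum_integral_integral_lse_le {Ω : Type*} {mΩ : MeasurableSpace Ω} {μ : Measure Ω}
    [IsProbabilityMeasure μ] {𝓕 : Filtration ℕ mΩ} {v B a L ρ : ℝ} {x w : ℕ → Ω → ℝ}
    (h : BoundedNoiseModel μ 𝓕 v (2 * B) x w) (hv : 0 < v) (hB : 0 < B)
    {fstar : ℝ → ℝ} (hfs : fstar ∈ lipClass)
    (hL1 : L < 1) (hf : ∀ y z, |fstar y - fstar z| ≤ L * |y - z|)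
    (hstep : ∀ t ω, x (t + 1) ω = fstar (x t ω) + w t ω) (hx : ∀ t ω, |x t ω| ≤ B)
    {T : ℕ} (hT : 1 ≤ T) {fhat : Ω → ℝ → ℝ} (hhat : IsLSE lipClass T x fhat)
    (ha : 0 < a) (haB : a ≤ B) (ha3 : a ^ 3 * T = v * B)
    (hρ : 1 ≤ ρ) (hρ3 : ρ ^ 3 = (1 - L) ^ 2 * T) :
    ∫ ω, ∑ t ∈ Finset.range T, ∫ ω', |fhat ω (x t ω') - fstar (x t ω')| ∂μ ∂μ
      ≤ (14 * a + 32 * (B / ρ)) * T := by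
  have hT' : (0 : ℝ) < T := by exact_mod_cast hT
  set N := ⌈ρ⌉₊ with hN
  have hN1 : ρ ≤ N := Nat.le_ceil _
  have hN2 : (N : ℝ) ≤ 2 * ρ := by
    have := Nat.ceil_lt_add_one (by linarith : 0 ≤ ρ)
    rw [← hN] at this
    linarith
  have hN' : (0 : ℝ) < N := by linarith
  set γ := 2 * B / N with hγ
  have hγ0 : 0 < γ := by positivity
  have hNγ : (N : ℝ) * γ = 2 * B := by rw [hγ]; field_simp
  have hγρ : γ ≤ 2 * (B / ρ) := by
    rw [hγ, mul_div_assoc]; gcongr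
  have hxm := h.state_measurable
  have hfm := measurable_uncurry_of_lipClass hhat.measurable hhat.mem
  have hfsm : Measurable fstar := hfs.2.2.continuous.measurable
  have hgb : ∀ t ω ω', |(|fhat ω (x t ω') - fstar (x t ω')|)| ≤ 1 := fun t ω ω' => by
    rw [abs_abs]; exact abs_sub_le_one_of_mem_lipClass (hhat.mem ω) hfs _
  have hg2 : ∀ t, Measurable fun p : Ω × Ω => |fhat p.1 (x t p.2) - fstar (x t p.2)| := fun t =>
    ((hfm.comp (measurable_fst.prodMk ((hxm t).comp measurable_snd))).sub
      (hfsm.comp ((hxm t).comp measurable_snd))).abs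
  have hg1 : ∀ t, Measurable fun ω => |fhat ω (x t ω) - fstar (x t ω)| := fun t =>
    (hg2 t).comp (measurable_id.prodMk measurable_id)
  have iL : Integrable (fun ω => ∑ t ∈ Finset.range T,
      ∫ ω', |fhat ω (x t ω') - fstar (x t ω')| ∂μ) μ :=
    integrable_finsetSum _ fun t _ =>
      (integrable_of_abs_le (μ := μ.prod μ) (hg2 t) fun p => hgb t p.1 p.2).integral_prod_left
  have i1 : Integrable (fun ω => ∑ t ∈ Finset.range T, |fhat ω (x t ω) - fstar (x t ω)|) μ :=
    integrable_finsetSum _ fun t _ => integrable_of_abs_le (hg1 t) fun ω => hgb t ω ω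
  have hri : ∀ k t, Integrable (fun ω => ramp B γ k (x t ω)) μ := fun k t =>
    integrable_of_abs_le ((measurable_ramp B γ k).comp (hxm t)) fun ω =>
      abs_ramp_le B hγ0.le k (x t ω)
  have i3 : Integrable (fun ω => ∑ k ∈ Finset.range N, |∑ t ∈ Finset.range T, ramp B γ k (x t ω)
            - ∫ ω', ∑ t ∈ Finset.range T, ramp B γ k (x t ω') ∂μ|) μ :=
    integrable_finsetSum _ fun k _ =>
      ((integrable_finsetSum _ fun t _ => hri k t).sub (integrable_const _)).abs
  have i2 : Integrable (fun ω => ∑ t ∈ Finset.range T, |fhat ω (x t ω) - fstar (x t ω)|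
      + 8 * γ * T) μ := i1.add (integrable_const _)
  -- The ramp inequality is pathwise and its right side involves `h` only through the sample sum, so
  -- it may be applied at each outcome to the data-dependent error function.
  have hmain := integral_mono iL (i2.add (i3.const_mul 2)) fun ω =>
    sum_integral_sub_le hxm hx (abs_abs_sub_sub_le (hhat.mem ω) hfs)
      (fun t => integrable_of_abs_le ((hg2 t).comp (measurable_const.prodMk measurable_id))
        fun ω' => hgb t ω ω') hγ0 hNγ T ω
  refine hmain.trans ?_
  simp only [Pi.add_apply]
  rw [integral_add i2 (i3.const_mul 2), integral_add i1 (integrable_const _),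
    integral_const_mul 2]
  simp only [integral_const, probReal_univ, one_smul]
  have b1 := integral_sum_abs_lse_le h hv hB hfs hstep hx hT hhat ha haB ha3
  have b2 := integral_sum_abs_ramp_dev_le h hB hfsm hL1 hf hstep hx hT (by linarith) hρ3
    hN2 hγ0.le
  have b3 : 8 * γ * T ≤ 8 * (2 * (B / ρ)) * T := by gcongr
  linarith

/-- The trivial bound: members of `lipClass` differ by at most `B` on `[-B, B]`. -/
lemma integral_sum_integral_le_of_bound {Ω : Type*} {mΩ : MeasurableSpace Ω} {μ : Measure Ω}
    [IsProbabilityMeasure μ] {B : ℝ} {x : ℕ → Ω → ℝ} (hx : ∀ t ω, |x t ω| ≤ B)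
    {fstar : ℝ → ℝ} (hfs : fstar ∈ lipClass) {fhat : Ω → ℝ → ℝ} (hhat : ∀ ω, fhat ω ∈ lipClass)
    (T : ℕ) :
    ∫ ω, ∑ t ∈ Finset.range T, ∫ ω', |fhat ω (x t ω') - fstar (x t ω')| ∂μ ∂μ ≤ T * B := by
  have h1 : ∀ t ω, ∫ ω', |fhat ω (x t ω') - fstar (x t ω')| ∂μ ≤ B := fun t ω => by
    have := norm_integral_le_of_norm_le_const (μ := μ)
      (f := fun ω' => |fhat ω (x t ω') - fstar (x t ω')|) (C := B)
      (Filter.Eventually.of_forall fun ω' => by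
        rw [Real.norm_eq_abs, abs_abs]
        exact abs_sub_le_bound_of_mem_lipClass (hhat ω) hfs (hx t ω'))
    rw [probReal_univ, mul_one] at this
    exact (le_abs_self _).trans this
  have h2 := norm_integral_le_of_norm_le_const (μ := μ)
      (f := fun ω => ∑ t ∈ Finset.range T, ∫ ω', |fhat ω (x t ω') - fstar (x t ω')| ∂μ)
      (C := T * B) (Filter.Eventually.of_forall fun ω => by
        rw [Real.norm_eq_abs, abs_of_nonneg (Finset.sum_nonneg fun t _ =>
          integral_nonneg fun ω' => abs_nonneg _)]
        exact (Finset.sum_le_sum fun t _ => h1 t ω).trans (by simp))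
  rw [probReal_univ, mul_one] at h2
  exact (le_abs_self _).trans h2

theorem mainTheorem9 :
    ∃ C : ℝ, 0 < C ∧
      ∀ {Ω : Type*} {mΩ : MeasurableSpace Ω} (μ : Measure Ω) [IsProbabilityMeasure μ]
        (𝓕 : Filtration ℕ mΩ) (fstar : ℝ → ℝ) (L : ℝ≥0) (σ B : ℝ) (x w : ℕ → Ω → ℝ),
        fstar ∈ lipClass → LipschitzWith L fstar → L < 1 → 0 ≤ σ →
        IsAutoregressive μ 𝓕 fstar σ x w →
        (∀ t, Indep (MeasurableSpace.comap (w t) inferInstance) (𝓕 t) μ) →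
        (∀ t ω, |x t ω| ≤ B) →
        ∀ (T : ℕ), 1 ≤ T → ∀ fhat : Ω → ℝ → ℝ, IsLSE lipClass T x fhat →
          Integrable (fun p : Ω × ℝ => |fhat p.1 p.2 - fstar p.2|)
            (μ.prod (mixtureLaw μ x T)) ∧
          ∫ p : Ω × ℝ, |fhat p.1 p.2 - fstar p.2| ∂(μ.prod (mixtureLaw μ x T)) ≤
            C * (B / (1 - (L : ℝ)) ^ (2 / 3 : ℝ) + B ^ (1 / 3 : ℝ) * σ ^ (2 / 3 : ℝ))
              * (T : ℝ) ^ (-(1 / 3) : ℝ) := by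
  -- The sum of the constants 14 (in-sample) and 32 (generalisation).
  refine ⟨46, by norm_num, ?_⟩
  intro Ω mΩ μ _ 𝓕 fstar L σ B x w hfs hfL hL1 hσ hAR hind hx T hT fhat hhat
  have hT' : (0 : ℝ) < T := by exact_mod_cast hT
  have hL1' : (L : ℝ) < 1 := by exact_mod_cast hL1
  have hL : 0 < 1 - (L : ℝ) := by linarith
  have hB0 : 0 ≤ B := by
    obtain ⟨ω⟩ := nonempty_of_isProbabilityMeasure μ
    exact (abs_nonneg _).trans (hx 0 ω)
  have := isFiniteMeasure_mixtureLaw μ x hT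
  have hxm : ∀ t, Measurable (x t) := fun t => (hAR.measurable_state t).mono (𝓕.le _) le_rfl
  have hfm := measurable_uncurry_of_lipClass hhat.measurable hhat.mem
  have hfsm : Measurable fstar := hfs.2.2.continuous.measurable
  have hint : Integrable (fun p : Ω × ℝ => |fhat p.1 p.2 - fstar p.2|)
      (μ.prod (mixtureLaw μ x T)) :=
    integrable_of_abs_le (C := 1) (hfm.sub (hfsm.comp measurable_snd)).abs fun p => by
      rw [abs_abs]; exact abs_sub_le_one_of_mem_lipClass (hhat.mem _) hfs _
  refine ⟨hint, ?_⟩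
  -- Independence of `ξ` is built into the product measure; Fubini freezes the estimator and
  -- averages over a fresh copy of the states.
  have hred : ∫ p : Ω × ℝ, |fhat p.1 p.2 - fstar p.2| ∂(μ.prod (mixtureLaw μ x T))
      = (T : ℝ)⁻¹ * ∫ ω, ∑ t ∈ Finset.range T,
          ∫ ω', |fhat ω (x t ω') - fstar (x t ω')| ∂μ ∂μ := by
    rw [integral_prod _ hint, ← integral_const_mul]
    refine integral_congr_ae (Filter.Eventually.of_forall fun ω => ?_)
    exact integral_mixtureLaw hxm T (h := fun z => |fhat ω z - fstar z|) (C := 1)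
      ((hhat.mem ω).2.2.continuous.measurable.sub hfsm).abs fun z => by
        rw [abs_abs]; exact abs_sub_le_one_of_mem_lipClass (hhat.mem _) hfs _
  rw [hred]
  set I := ∫ ω, ∑ t ∈ Finset.range T, ∫ ω', |fhat ω (x t ω') - fstar (x t ω')| ∂μ ∂μ with hI
  have htriv : (T : ℝ)⁻¹ * I ≤ B := by
    rw [inv_mul_le_iff₀ hT']
    exact integral_sum_integral_le_of_bound hx hfs hhat.mem T
  set τ := (T : ℝ) ^ (-(1 / 3) : ℝ) with hτ
  have hτ0 : 0 < τ := by positivity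
  have hτ3 : τ ^ 3 * T = 1 := by
    rw [hτ, ← Real.rpow_natCast, ← Real.rpow_mul hT'.le]
    norm_num [Real.rpow_neg_one, hT'.ne']
  set ℓ := (1 - (L : ℝ)) ^ (2 / 3 : ℝ) with hℓ
  have hℓ0 : 0 < ℓ := by positivity
  have hℓ3 : ℓ ^ 3 = (1 - (L : ℝ)) ^ 2 := by
    rw [hℓ, ← Real.rpow_natCast, ← Real.rpow_mul hL.le, ← Real.rpow_natCast]
    norm_num
  have hℓ1 : ℓ ≤ 1 := Real.rpow_le_one hL.le (by linarith [L.coe_nonneg]) (by norm_num)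
  set β := B ^ (1 / 3 : ℝ) * σ ^ (2 / 3 : ℝ) with hβ
  have hβ0 : 0 ≤ β := by positivity
  have hβ3 : β ^ 3 = B * σ ^ 2 := by
    rw [hβ, mul_pow, ← Real.rpow_natCast, ← Real.rpow_mul hB0, ← Real.rpow_natCast,
      ← Real.rpow_mul hσ, ← Real.rpow_natCast]
    norm_num
  have hBℓ : B ≤ B / ℓ := le_div_self hB0 hℓ0 hℓ1
  -- The summand `B` keeps `a` positive when `σ = 0`, and is absorbed by `B / ℓ` since `ℓ ≤ 1`.
  set a := (β + B) * τ with ha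
  have has : a ≤ (B / ℓ + β) * τ :=
    mul_le_mul_of_nonneg_right (by linarith) hτ0.le
  have hρs : B / (ℓ / τ) ≤ (B / ℓ + β) * τ := by
    rw [div_div_eq_mul_div, mul_div_right_comm]
    gcongr; linarith
  have hS0 : 0 ≤ (B / ℓ + β) * τ := by positivity
  rw [mul_assoc]
  -- When `B = 0`, `B < a` or `ℓ / τ < 1`, the claimed bound already exceeds the trivial bound `B`.
  rcases hB0.eq_or_lt with hBz | hB
  · linarith
  rcases lt_or_ge B a with hBa | hBa
  · linarith
  rcases lt_or_ge (ℓ / τ) 1 with hρ | hρ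
  · have : B ≤ B / (ℓ / τ) := le_div_self hB0 (by positivity) hρ.le
    linarith
  have ha0 : 0 < a := by positivity
  -- The variance proxy is inflated to the value for which `a³ T = v B` holds exactly.
  have hv : σ ^ 2 ≤ a ^ 3 * T / B := by
    rw [le_div_iff₀ hB]
    calc σ ^ 2 * B = β ^ 3 * (τ ^ 3 * T) := by rw [hτ3, hβ3]; ring
      _ ≤ (β + B) ^ 3 * (τ ^ 3 * T) := by gcongr; linarith
      _ = a ^ 3 * T := by rw [ha]; ring
  have hmodel := hAR.boundedNoiseModel hfs hind hx hv
  have hmain := sum_integral_integral_lse_le hmodel (by positivity) hB hfs hL1'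
    (fun y z => by simpa [Real.dist_eq] using hfL.dist_le_mul y z) hAR.step hx hT hhat ha0 hBa
    (div_mul_cancel₀ _ hB.ne').symm hρ (by
      rw [div_pow, hℓ3, div_eq_iff (by positivity), mul_assoc, mul_comm (T : ℝ), hτ3, mul_one])
  have : (T : ℝ)⁻¹ * I ≤ 14 * a + 32 * (B / (ℓ / τ)) := by
    rw [inv_mul_le_iff₀ hT', mul_comm (T : ℝ)]
    exact hmain
  linarith
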